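/- Let $N\ge 1$, $t,r,M\ge 0$ with $t+r\le N$ and $K-M\ge N$. Put $E_t=\begin{bmatrix}I_t&0\end{bmatrix}^T\in\mathbb C^{N\times t}$, $E_r=\begin{bmatrix}0_{r\times t}&I_r&0\end{bmatrix}^T\in\mathbb C^{N\times r}$, $A=[E_t\;E_r]$, $C=[I_M\;0]\in\mathbb C^{M\times K}$. Consider data $Z\in\mathbb C^{N\times K}$ with density $$f_1(Z;B_s,R)=\pi^{-NK}\det(R)^{-K}\exp\!\big(-\mathrm{Tr}[R^{-1}(Z-AB_sC)(Z-AB_sC)^\dagger]\big)$$ under $H_1$, where $B_s=[B_t^T\;B^T]^T$ with $B_t\in\mathbb C^{t\times M}$, $B\in\mathbb C^{r\times M}$ and $R$ (Hermitian positive definite) unknown, and with density $f_0(Z;B_t,R)$ obtained by replacing $AB_sC$ with $E_tB_tC$ under $H_0$ (i.e. $B=0$). Write $P_X=X(X^\dagger X)^{-1}X^\dagger$. Let $S_c=Z_{c,\perp}Z_{c,\perp}^\dagger$, where $Z_{c,\perp}$ consists of the last $K-M$ columns of $Z$ (the secondary data), and put $Z_{W1}=S_c^{-1/2}Z$, $A_1=S_c^{-1/2}A$,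 $A_0=S_c^{-1/2}E_t$. The two-step GLR statistic $t_{2s}(Z)$ is the known-$R$ statistic $\ln\dfrac{\max_{B_s}f_1(Z;B_s,R)}{\max_{B_t}f_0(Z;B_t,R)}$ evaluated at $R=(K-M)^{-1}S_c$. The Wald statistic is $t_W(Z)=\hat\theta_{r,1}^T\{[I^{-1}(\hat\theta_1)]_{\theta_r,\theta_r}\}^{-1}\hat\theta_{r,1}$, where the real vector $\theta=(\theta_r,\theta_s)$ collects the real and imaginary parts of the entries of $B$ (this is $\theta_r$) and of $B_t$, and the $N^2$ real coordinates of $R$; $\hat\theta_1$ is the maximum likelihood estimate of $\theta$ under $H_1$, and $I(\theta)$ is the Fisher information matrix of $f_1$. Then: 1. For every positive definite $R$ and every $Z$ both maxima are attained and $$\ln\frac{\max_{B_s}f_1(Z;B_s,R)}{\max_{B_t}f_0(Z;B_t,R)}=\mathrm{Tr}\big[Z^\dagger R^{-1/2}(P_{R^{-1/2}A}-P_{R^{-1/2}E_t})R^{-1/2}ZP_{C^\dagger}\big].$$ 2. Under both hypotheses, for all values of the parameters, $S_c$ is almost surely positive definite. Whenever $S_c$ is positive definite, the maximum likelihood estimate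 under $H_1$ exists and is unique, and $$t_{2s}(Z)=(K-M)\,\mathrm{Tr}\big[Z_{W1}^\dagger(P_{A_1}-P_{A_0})Z_{W1}P_{C^\dagger}\big],\qquad t_W(Z)=2K\,\mathrm{Tr}\big[Z_{W1}^\dagger(P_{A_1}-P_{A_0})Z_{W1}P_{C^\dagger}\big],$$ so that $t_{2s}(Z)=\frac{K-M}{2K}\,t_W(Z)$. 3. Consequently the two-step GLR and the Wald statistics are statistically equivalent: almost surely, under both hypotheses and for all values of the parameters, one is a fixed increasing bijective function of the other, so the two tests coincide up to a change of threshold. 4. Both tests are CFAR: for every threshold $\eta$, the probability under $H_0$ that the statistic exceeds $\eta$ does not depend on $(B_t,R)$. -/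

import Mathlib

open MeasureTheory Matrix
open scoped ComplexOrder MatrixOrder

noncomputable section

namespace IGMANOVA

/-! Dimensions: `N` rows (sensors), `K` columns (snapshots), right subspace of dimension `M`,
interference subspace of dimension `t`, useful-signal subspace of dimension `r`. -/

/-- Left interference subspace `E_t = [I_t ; 0]`, of size `N × t`. -/
def Et (N t : ℕ) : Matrix (Fin N) (Fin t) ℂ :=
  Matrix.of fun i j => if i.val = j.val then 1 else 0

/-- Left useful-signal subspace `E_r = [0_{r × t}, I_r, 0]ᵀ`, of size `N × r`. -/
def Er (N t r : ℕ) : Matrix (Fin N) (Fin r) ℂ :=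
  Matrix.of fun i j => if i.val = t + j.val then 1 else 0

/-- `A = [E_t  E_r]`. -/
def A (N t r : ℕ) : Matrix (Fin N) (Fin t ⊕ Fin r) ℂ :=
  Matrix.fromCols (Et N t) (Er N t r)

/-- Right subspace `C = [I_M  0]`, of size `M × K`. -/
def C (M K : ℕ) : Matrix (Fin M) (Fin K) ℂ :=
  Matrix.of fun i j => if j.val = i.val then 1 else 0

/-- `V_{c,2} = [0 ; I_{K-M}]`, selecting the signal-free columns. -/
def Vc2 (M K : ℕ) : Matrix (Fin K) (Fin (K - M)) ℂ :=
  Matrix.of fun i j => if i.val = M + j.val then 1 else 0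

/-- Orthogonal projection `P_X = X (X† X)⁻¹ X†` of a full-column-rank matrix. -/
def proj {m n : Type*} [Fintype n] [DecidableEq n] [Fintype m] (X : Matrix m n ℂ) :
    Matrix m m ℂ :=
  X * (Xᴴ * X)⁻¹ * Xᴴ

/-- `S^{-1/2}`: the inverse of the Hermitian positive square root of a positive definite `S`. -/
def invSqrt {N : ℕ} (S : Matrix (Fin N) (Fin N) ℂ) : Matrix (Fin N) (Fin N) ℂ :=
  (CFC.sqrt S)⁻¹

/-- Secondary (signal-free) data `Z_{c,⊥} = Z V_{c,2}`. -/
def secondary {N K : ℕ} (M : ℕ) (Z : Matrix (Fin N) (Fin K) ℂ) :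
    Matrix (Fin N) (Fin (K - M)) ℂ :=
  Z * Vc2 M K

/-- `S_c = Z_{c,⊥} Z_{c,⊥}†`. -/
def Sc {N K : ℕ} (M : ℕ) (Z : Matrix (Fin N) (Fin K) ℂ) : Matrix (Fin N) (Fin N) ℂ :=
  secondary M Z * (secondary M Z)ᴴ

/-- Secondary-data covariance estimate `(K - M)⁻¹ S_c`. -/
def Rsd {N K : ℕ} (M : ℕ) (Z : Matrix (Fin N) (Fin K) ℂ) : Matrix (Fin N) (Fin N) ℂ :=
  ((K : ℂ) - (M : ℂ))⁻¹ • Sc M Z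

/-! ### The statistical model -/

/-- Density at `Z` (with respect to Lebesgue measure on `ℂ^{N × K}`) of a complex proper Gaussian
matrix with mean `X` and independent columns of covariance `R`:
`π^{-NK} det(R)^{-K} exp(-Tr[R⁻¹ (Z - X)(Z - X)†])`. -/
def gaussianPdf {N K : ℕ} (X : Matrix (Fin N) (Fin K) ℂ) (R : Matrix (Fin N) (Fin N) ℂ)
    (Z : Matrix (Fin N) (Fin K) ℂ) : ℝ :=
  (Real.pi ^ (N * K))⁻¹ * (R.det.re ^ K)⁻¹ *
    Real.exp (-(Matrix.trace (R⁻¹ * ((Z - X) * (Z - X)ᴴ))).re)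

/-- Likelihood under `H₁`: mean `A B_s C`, where `B_s = [B_t ; B]` stacks the interference
coefficients `B_t` and the useful-signal coefficients `B`. -/
def f1 {N K M t r : ℕ} (Z : Matrix (Fin N) (Fin K) ℂ) (Bs : Matrix (Fin t ⊕ Fin r) (Fin M) ℂ)
    (R : Matrix (Fin N) (Fin N) ℂ) : ℝ :=
  gaussianPdf (A N t r * Bs * C M K) R Z

/-- Likelihood under `H₀`: mean `E_t B_t C`. -/
def f0 {N K M t : ℕ} (Z : Matrix (Fin N) (Fin K) ℂ) (Bt : Matrix (Fin t) (Fin M) ℂ)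
    (R : Matrix (Fin N) (Fin N) ℂ) : ℝ :=
  gaussianPdf (Et N t * Bt * C M K) R Z

/-- Law of the data under `H₁`: density `f1` with respect to Lebesgue measure. -/
def law1 {N M t r : ℕ} (K : ℕ) (Bs : Matrix (Fin t ⊕ Fin r) (Fin M) ℂ)
    (R : Matrix (Fin N) (Fin N) ℂ) : Measure (Fin N → Fin K → ℂ) :=
  volume.withDensity fun z => ENNReal.ofReal (f1 (Matrix.of z) Bs R)

/-- Law of the data under `H₀`: density `f0` with respect to Lebesgue measure. -/
def law0 {N M t : ℕ} (K : ℕ) (Bt : Matrix (Fin t) (Fin M) ℂ)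
    (R : Matrix (Fin N) (Fin N) ℂ) : Measure (Fin N → Fin K → ℂ) :=
  volume.withDensity fun z => ENNReal.ofReal (f0 (Matrix.of z) Bt R)

/-! ### The two-step GLR statistic -/

/-- GLR statistic for known `R`: `max_{B_s} f1(Z; B_s, R) / max_{B_t} f0(Z; B_t, R)`. -/
def glrKnown {N K : ℕ} (M t r : ℕ) (R : Matrix (Fin N) (Fin N) ℂ)
    (Z : Matrix (Fin N) (Fin K) ℂ) : ℝ :=
  (⨆ Bs : Matrix (Fin t ⊕ Fin r) (Fin M) ℂ, f1 Z Bs R) /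
    (⨆ Bt : Matrix (Fin t) (Fin M) ℂ, f0 Z Bt R)

/-- Two-step GLR statistic: the known-`R` GLR (in logarithmic form), with the secondary-data
covariance estimate plugged in for `R`. -/
def twoStepGLR {N K : ℕ} (M t r : ℕ) (Z : Matrix (Fin N) (Fin K) ℂ) : ℝ :=
  Real.log (glrKnown M t r (Rsd M Z) Z)

/-- `Tr[Z† R^{-1/2} (P_{R^{-1/2} A} - P_{R^{-1/2} E_t}) R^{-1/2} Z P_{C†}]`. -/
def knownCovTrace {N K : ℕ} (M t r : ℕ) (R : Matrix (Fin N) (Fin N) ℂ)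
    (Z : Matrix (Fin N) (Fin K) ℂ) : ℂ :=
  Matrix.trace (Zᴴ * invSqrt R *
    (proj (invSqrt R * A N t r) - proj (invSqrt R * Et N t)) *
    invSqrt R * Z * proj (C M K)ᴴ)

/-! ### The Wald statistic -/

/-- Whitened data `Z_{W1} = S_c^{-1/2} Z`. -/
def ZW1 {N K : ℕ} (M : ℕ) (Z : Matrix (Fin N) (Fin K) ℂ) : Matrix (Fin N) (Fin K) ℂ :=
  invSqrt (Sc M Z) * Z

/-- `A_1 = S_c^{-1/2} A`. -/
def A1 {N K : ℕ} (M t r : ℕ) (Z : Matrix (Fin N) (Fin K) ℂ) : Matrix (Fin N) (Fin t ⊕ Fin r) ℂ :=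
  invSqrt (Sc M Z) * A N t r

/-- `A_0 = S_c^{-1/2} E_t`. -/
def A0 {N K : ℕ} (M t : ℕ) (Z : Matrix (Fin N) (Fin K) ℂ) : Matrix (Fin N) (Fin t) ℂ :=
  invSqrt (Sc M Z) * Et N t

/-- Closed form `Tr[Z_{W1}† (P_{A_1} - P_{A_0}) Z_{W1} P_{C†}]`. -/
def waldTrace {N K : ℕ} (M t r : ℕ) (Z : Matrix (Fin N) (Fin K) ℂ) : ℂ :=
  Matrix.trace ((ZW1 M Z)ᴴ * (proj (A1 M t r Z) - proj (A0 M t Z)) * ZW1 M Z * proj (C M K)ᴴ)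

/-- Indices of the parameters of interest `θ_r`: real parts, then imaginary parts, of the entries
of `B`. -/
abbrev IdxR (r M : ℕ) : Type := (Fin r × Fin M) ⊕ (Fin r × Fin M)

/-- Indices of the nuisance parameters `θ_s`: real and imaginary parts of the entries of `B_t`,
and `N²` real coordinates of the Hermitian matrix `R`. -/
abbrev IdxS (N t M : ℕ) : Type := ((Fin t × Fin M) ⊕ (Fin t × Fin M)) ⊕ (Fin N × Fin N)

/-- The overall real parameter vector `θ = (θ_r, θ_s)`. -/
abbrev Param (N t r M : ℕ) : Type := IdxR r M ⊕ IdxS N t M → ℝ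

/-- The coefficient matrix `B_s = [B_t ; B]` encoded by `θ`. -/
def BsOf {N t r M : ℕ} (θ : Param N t r M) : Matrix (Fin t ⊕ Fin r) (Fin M) ℂ :=
  Matrix.fromRows
    (Matrix.of fun i j => (θ (.inr (.inl (.inl (i, j)))) : ℂ) +
      Complex.I * (θ (.inr (.inl (.inr (i, j)))) : ℂ))
    (Matrix.of fun i j => (θ (.inl (.inl (i, j))) : ℂ) +
      Complex.I * (θ (.inl (.inr (i, j))) : ℂ))

/-- The Hermitian matrix `R` encoded by `θ`. The coordinate `(i, i)` is the diagonal entry `R i i`;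
for `i < j` the coordinates `(i, j)` and `(j, i)` are the real and imaginary parts of `R i j`. -/
def ROf {N t r M : ℕ} (θ : Param N t r M) : Matrix (Fin N) (Fin N) ℂ :=
  Matrix.of fun i j =>
    if i = j then (θ (.inr (.inr (i, i))) : ℂ)
    else if i < j then
      (θ (.inr (.inr (i, j))) : ℂ) + Complex.I * (θ (.inr (.inr (j, i))) : ℂ)
    else (θ (.inr (.inr (j, i))) : ℂ) - Complex.I * (θ (.inr (.inr (i, j))) : ℂ)

/-- The parameter vector of a pair `(B_s, R)`, with `R` Hermitian (inverse of
`θ ↦ (BsOf θ, ROf θ)`). -/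
def paramOf {N t r M : ℕ} (p : Matrix (Fin t ⊕ Fin r) (Fin M) ℂ × Matrix (Fin N) (Fin N) ℂ) :
    Param N t r M :=
  Sum.elim
    (Sum.elim (fun ij => (p.1 (.inr ij.1) ij.2).re) (fun ij => (p.1 (.inr ij.1) ij.2).im))
    (Sum.elim
      (Sum.elim (fun ij => (p.1 (.inl ij.1) ij.2).re) (fun ij => (p.1 (.inl ij.1) ij.2).im))
      (fun ij => if ij.1 ≤ ij.2 then (p.2 ij.1 ij.2).re else (p.2 ij.2 ij.1).im))

/-- The score: partial derivative of `ln f1(Z; θ)` in the coordinate `a`, at `θ`. -/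
def score {N K t r M : ℕ} (θ : Param N t r M) (a : IdxR r M ⊕ IdxS N t M)
    (Z : Matrix (Fin N) (Fin K) ℂ) : ℝ :=
  lineDeriv ℝ (fun θ' : Param N t r M => Real.log (f1 Z (BsOf θ') (ROf θ'))) θ (Pi.single a 1)

/-- Fisher information matrix `I(θ) = E_θ[(∂ ln f1 / ∂θ)(∂ ln f1 / ∂θ)ᵀ]` of the data with `K`
columns. -/
def fisher {N t r M : ℕ} (K : ℕ) (θ : Param N t r M) :
    Matrix (IdxR r M ⊕ IdxS N t M) (IdxR r M ⊕ IdxS N t M) ℝ :=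
  Matrix.of fun a b =>
    ∫ z, score θ a (Matrix.of z) * score θ b (Matrix.of z) ∂(law1 K (BsOf θ) (ROf θ))

/-- `(B_s, R)` is a maximum likelihood estimate under `H₁`: `R` is positive definite and `f1` is
maximal there among all `B_s` and all positive definite `R`. -/
def IsMLE1 {N K t r M : ℕ} (Z : Matrix (Fin N) (Fin K) ℂ)
    (p : Matrix (Fin t ⊕ Fin r) (Fin M) ℂ × Matrix (Fin N) (Fin N) ℂ) : Prop :=
  p.2.PosDef ∧ ∀ (Bs : Matrix (Fin t ⊕ Fin r) (Fin M) ℂ) (R : Matrix (Fin N) (Fin N) ℂ),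
    R.PosDef → f1 Z Bs R ≤ f1 Z p.1 p.2

open Classical in
/-- The maximum likelihood estimate under `H₁` (where it exists). -/
def mle1 {N K : ℕ} (M t r : ℕ) (Z : Matrix (Fin N) (Fin K) ℂ) :
    Matrix (Fin t ⊕ Fin r) (Fin M) ℂ × Matrix (Fin N) (Fin N) ℂ :=
  if h : ∃ p, IsMLE1 Z p then h.choose else 0

/-- The quadratic form `θ_rᵀ {[I⁻¹(θ)]_{θ_r, θ_r}}⁻¹ θ_r`. -/
def waldForm {N t r M : ℕ} (K : ℕ) (θ : Param N t r M) : ℝ :=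
  (fun a => θ (.inl a)) ⬝ᵥ (((fisher K θ)⁻¹.toBlocks₁₁)⁻¹ *ᵥ fun a => θ (.inl a))

/-- Wald statistic
`(θ̂_{r,1} - θ_{r,0})ᵀ {[I⁻¹(θ̂_1)]_{θ_r, θ_r}}⁻¹ (θ̂_{r,1} - θ_{r,0})`, where `θ_{r,0} = 0` and `θ̂_1`
is the maximum likelihood estimate under `H₁`. -/
def wald {N K : ℕ} (M t r : ℕ) (Z : Matrix (Fin N) (Fin K) ℂ) : ℝ :=
  waldForm K (paramOf (mle1 M t r Z))

/-! ### Properties of tests -/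

/-- Two statistics are statistically equivalent: almost surely, whatever the hypothesis and the
parameters, one is a fixed strictly increasing bijective function of the other. The tests "decide
`H₁` when the statistic exceeds a threshold" then coincide up to a change of threshold. -/
def StatEquivalent {N K : ℕ} (M t r : ℕ) (T T' : Matrix (Fin N) (Fin K) ℂ → ℝ) : Prop :=
  ∃ g : ℝ ≃o ℝ,
    (∀ (Bt : Matrix (Fin t) (Fin M) ℂ) (R : Matrix (Fin N) (Fin N) ℂ), R.PosDef →
      ∀ᵐ z ∂(law0 K Bt R), T (Matrix.of z) = g (T' (Matrix.of z))) ∧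
    (∀ (Bs : Matrix (Fin t ⊕ Fin r) (Fin M) ℂ) (R : Matrix (Fin N) (Fin N) ℂ), R.PosDef →
      ∀ᵐ z ∂(law1 K Bs R), T (Matrix.of z) = g (T' (Matrix.of z)))

/-- Constant false alarm rate: for every threshold `η` the probability under `H₀` that the
statistic exceeds `η` does not depend on the nuisance parameters `(B_t, R)`. -/
def CFAR {N K : ℕ} (M t : ℕ) (T : Matrix (Fin N) (Fin K) ℂ → ℝ) : Prop :=
  ∀ η : ℝ, ∃ Pfa : ENNReal,
    ∀ (Bt : Matrix (Fin t) (Fin M) ℂ) (R : Matrix (Fin N) (Fin N) ℂ), R.PosDef →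
      law0 K Bt R {z | η < T (Matrix.of z)} = Pfa

end IGMANOVA

end

open IGMANOVA

/-! Both statistics are built from one weighted least squares problem. Put `Y = Z C†`. The rows of
`C` are orthonormal and the mean vanishes on the secondary columns, so the residual Gram matrix is
`S_c + (Y - X B)(Y - X B)†` (`residual_gram`). Completing the square with a weight `G`
(`complete_square`) leaves the kernel `wproj X G` and a nonnegative term in `B`.

For known `R` the weight is `R⁻¹`. The maximized exponents under the two hypotheses differ by `Tr[Y†
(wproj A R⁻¹ - wproj E_t R⁻¹) Y]`, and substituting `R = S_c / (K - M)` only multiplies this kernel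
by `K - M`.

For the Wald statistic, `log x ≤ x - 1` applied to the eigenvalues of a whitened matrix shows that,
at fixed `B_s`, the best covariance is the residual Gram matrix over `K`. It remains to minimize the
determinant of that matrix. Sylvester's identity turns it into an `M × M` determinant, in which the
completed square shows that least squares with weight `S_c⁻¹` is the unique minimizer
(`isMLE1_iff`). The residual is `S_c⁻¹`-orthogonal to the columns of `A`, hence `R̂⁻¹ A = K S_c⁻¹ A`
(`inv_covHat_mul_A`); this is the source of the factor `K`.

The Fisher matrix need not be inverted. Written in whitened Gaussian noise, a score is an odd linear
part, from the mean, plus an even quadratic part, from the covariance, and the two are uncorrelated.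
If the nuisance rows of `I` annihilate a vector `v` whose interest part is `θ_r`, the Wald form
equals `vᵀ I v` (`block_inv_quadraticForm`). Such a `v` comes from subtracting from the estimate of
`B_s` the fit on `E_t` alone (`wald_eq`).

Positive definiteness of `S_c` is generic because `K - M ≥ N`: a determinant can vanish only on a
null set. For CFAR, factor `R = L L†` with `L` upper triangular: such an `L` preserves the spans of
`E_t` and `A`, so the trace is unchanged under `Z ↦ L Z + E_t B_t C` and its law under `H₀` is the
one for standard noise (`waldTrace_affine`). -/

namespace IGMANOVA

noncomputable section

/-! ### Weighted least squares -/

section WeightedLeastSquares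

variable {n m k : Type*} [Fintype n] [Fintype m] [DecidableEq m]

/-- The `G`-weighted projection kernel `G X (X† G X)⁻¹ X† G`. -/
def wproj (X : Matrix n m ℂ) (G : Matrix n n ℂ) : Matrix n n ℂ :=
  G * X * (Xᴴ * G * X)⁻¹ * Xᴴ * G

/-- The `G`-weighted least squares solution of `X B ≈ Y`. -/
def wls (X : Matrix n m ℂ) (G : Matrix n n ℂ) (Y : Matrix n k ℂ) : Matrix m k ℂ :=
  (Xᴴ * G * X)⁻¹ * (Xᴴ * (G * Y))

theorem gram_posDef [DecidableEq n] {X : Matrix n m ℂ} {G : Matrix n n ℂ} (hX : Xᴴ * X = 1)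
    (hG : G.PosDef) : (Xᴴ * G * X).PosDef := by
  refine hG.conjTranspose_mul_mul_same fun v w h => ?_
  have := congrArg (fun u => Xᴴ *ᵥ u) h
  simpa [hX] using this

theorem gram_isUnit_det [DecidableEq n] {X : Matrix n m ℂ} {G : Matrix n n ℂ} (hX : Xᴴ * X = 1)
    (hG : G.PosDef) : IsUnit (Xᴴ * G * X).det :=
  (Matrix.isUnit_iff_isUnit_det _).1 (gram_posDef hX hG).isUnit

theorem gram_mul_wls [DecidableEq n] {X : Matrix n m ℂ} {G : Matrix n n ℂ} (hX : Xᴴ * X = 1)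
    (hG : G.PosDef) (Y : Matrix n k ℂ) :
    Xᴴ * (G * (X * wls X G Y)) = Xᴴ * (G * Y) := by
  have := Matrix.mul_nonsing_inv_cancel_left (Xᴴ * G * X) (Xᴴ * (G * Y)) (gram_isUnit_det hX hG)
  simpa only [wls, Matrix.mul_assoc] using this

theorem wproj_mul (X : Matrix n m ℂ) (G : Matrix n n ℂ) (Y : Matrix n k ℂ) :
    wproj X G * Y = G * (X * wls X G Y) := by
  simp only [wproj, wls, Matrix.mul_assoc]

theorem wls_mul_self [DecidableEq n] {X : Matrix n m ℂ} {G : Matrix n n ℂ} (hX : Xᴴ * X = 1)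
    (hG : G.PosDef) (B : Matrix m k ℂ) : wls X G (X * B) = B := by
  have := Matrix.nonsing_inv_mul_cancel_left (Xᴴ * G * X) B (gram_isUnit_det hX hG)
  simpa only [wls, Matrix.mul_assoc] using this

theorem wproj_isHermitian {X : Matrix n m ℂ} {G : Matrix n n ℂ} (hG : G.IsHermitian) :
    (wproj X G).IsHermitian := by
  unfold wproj Matrix.IsHermitian
  simp only [conjTranspose_mul, conjTranspose_nonsing_inv, conjTranspose_conjTranspose, hG.eq,
    Matrix.mul_assoc]

theorem residual_orthogonal [DecidableEq n] {X : Matrix n m ℂ} {G : Matrix n n ℂ} (hX : Xᴴ * X = 1)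
    (hG : G.PosDef) (Y : Matrix n k ℂ) : Xᴴ * (G * (Y - X * wls X G Y)) = 0 := by
  rw [Matrix.mul_sub, Matrix.mul_sub, gram_mul_wls hX hG, sub_self]

/-- Pythagoras in the geometry of `G`: the least squares residual is `G`-orthogonal to the range of
`X`, so the cross terms vanish. The identity is kept at matrix level because the likelihood estimate
needs its determinant, not only its trace. -/
theorem complete_square [DecidableEq n] {X : Matrix n m ℂ} {G : Matrix n n ℂ} (hX : Xᴴ * X = 1)
    (hG : G.PosDef) (Y : Matrix n k ℂ) (B : Matrix m k ℂ) :
    (Y - X * B)ᴴ * G * (Y - X * B) =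
      Yᴴ * (G - wproj X G) * Y + (B - wls X G Y)ᴴ * (Xᴴ * G * X) * (B - wls X G Y) := by
  set D := Y - X * wls X G Y with hD
  have h0 : Xᴴ * (G * D) = 0 := residual_orthogonal hX hG Y
  have h0' : Dᴴ * (G * X) = 0 := by
    have := congrArg conjTranspose h0
    simpa only [conjTranspose_mul, conjTranspose_conjTranspose, hG.isHermitian.eq,
      conjTranspose_zero, Matrix.mul_assoc] using this
  have h1 : Y - X * B = D - X * (B - wls X G Y) := by
    rw [hD, Matrix.mul_sub]; abel
  have h2 : Yᴴ * (G - wproj X G) * Y = Dᴴ * (G * D) := by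
    have e1 : (G - wproj X G) * Y = G * D := by
      rw [Matrix.sub_mul, wproj_mul, hD, Matrix.mul_sub]
    have e2 : Yᴴ = Dᴴ + (wls X G Y)ᴴ * Xᴴ := by
      rw [hD, conjTranspose_sub, conjTranspose_mul]; abel
    rw [Matrix.mul_assoc, e1, e2, Matrix.add_mul, Matrix.mul_assoc _ Xᴴ, h0, Matrix.mul_zero,
      add_zero]
  rw [h2, h1]
  generalize B - wls X G Y = Δ
  rw [conjTranspose_sub, conjTranspose_mul]
  have e3 : (Dᴴ - Δᴴ * Xᴴ) * G * (D - X * Δ) = Dᴴ * (G * D) - (Dᴴ * (G * X)) * Δ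
      - Δᴴ * (Xᴴ * (G * D)) + Δᴴ * (Xᴴ * G * X) * Δ := by
    simp only [Matrix.sub_mul, Matrix.mul_sub, Matrix.mul_assoc]; abel
  rw [e3, h0, h0']; simp

end WeightedLeastSquares

/-! ### Inverse square roots -/

section InvSqrt

variable {N : ℕ} {S : Matrix (Fin N) (Fin N) ℂ}

theorem sqrt_isHermitian (S : Matrix (Fin N) (Fin N) ℂ) : (CFC.sqrt S).IsHermitian :=
  (Matrix.nonneg_iff_posSemidef.1 (CFC.sqrt_nonneg S)).isHermitian

theorem sqrt_mul_sqrt (hS : S.PosDef) : CFC.sqrt S * CFC.sqrt S = S :=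
  CFC.sqrt_mul_sqrt_self S (Matrix.nonneg_iff_posSemidef.2 hS.posSemidef)

theorem invSqrt_isHermitian (S : Matrix (Fin N) (Fin N) ℂ) : (invSqrt S).IsHermitian :=
  (sqrt_isHermitian S).inv

theorem invSqrt_mul_invSqrt (hS : S.PosDef) : invSqrt S * invSqrt S = S⁻¹ := by
  rw [invSqrt, ← Matrix.mul_inv_rev, sqrt_mul_sqrt hS]

/-- Removes the square roots: the whitened projections enter only through this product, which
depends on `S⁻¹` alone. -/
theorem invSqrt_proj (hS : S.PosDef) {m : Type*} [Fintype m] [DecidableEq m]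
    (X : Matrix (Fin N) m ℂ) :
    invSqrt S * proj (invSqrt S * X) * invSqrt S = wproj X S⁻¹ := by
  have h := invSqrt_mul_invSqrt hS
  simp only [proj, wproj, conjTranspose_mul, (invSqrt_isHermitian S).eq, ← h, Matrix.mul_assoc]

end InvSqrt

/-! ### The subspaces of the model -/

theorem sum_indicator_mul {n a : ℕ} (ha : a < n) (b : ℕ) :
    ∑ x : Fin n, (if x.val = a then (1 : ℂ) else 0) * (if x.val = b then 1 else 0) =
      if a = b then 1 else 0 := by
  rw [Finset.sum_eq_single_of_mem (⟨a, ha⟩ : Fin n) (Finset.mem_univ _)]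
  · simp
  · intro x _ hx
    have : x.val ≠ a := fun h => hx (Fin.ext h)
    simp [this]

theorem Et_orthonormal {N t : ℕ} (h : t ≤ N) : (Et N t)ᴴ * Et N t = 1 := by
  ext i j
  simp only [Et, Matrix.mul_apply, conjTranspose_apply, of_apply, apply_ite star, star_one,
    star_zero, Matrix.one_apply, Fin.ext_iff]
  exact sum_indicator_mul (by omega) _

theorem Er_orthonormal {N t r : ℕ} (h : t + r ≤ N) : (Er N t r)ᴴ * Er N t r = 1 := by
  ext i j
  simp only [Er, Matrix.mul_apply, conjTranspose_apply, of_apply, apply_ite star, star_one,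
    star_zero, Matrix.one_apply, Fin.ext_iff]
  rw [sum_indicator_mul (by omega)]
  simp

theorem Et_mul_Er {N t r : ℕ} (h : t + r ≤ N) : (Et N t)ᴴ * Er N t r = 0 := by
  ext i j
  simp only [Et, Er, Matrix.mul_apply, conjTranspose_apply, of_apply, apply_ite star, star_one,
    star_zero, Matrix.zero_apply]
  rw [sum_indicator_mul (by omega), if_neg (by omega)]

theorem A_orthonormal {N t r : ℕ} (h : t + r ≤ N) : (A N t r)ᴴ * A N t r = 1 := by
  have h1 := Et_mul_Er h
  have h2 : (Er N t r)ᴴ * Et N t = 0 := by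
    rw [← conjTranspose_conjTranspose (Et N t), ← conjTranspose_mul, h1, conjTranspose_zero]
  rw [A, conjTranspose_fromCols_eq_fromRows_conjTranspose, fromRows_mul_fromCols,
    Et_orthonormal (by omega), Er_orthonormal h, h1, h2, fromBlocks_one]

theorem A_mul_inl {N t r : ℕ} {k : Type*} (B : Matrix (Fin t) k ℂ) :
    A N t r * Matrix.fromRows B (0 : Matrix (Fin r) k ℂ) = Et N t * B := by
  rw [A, fromCols_mul_fromRows]; simp

theorem C_orthonormal {M K : ℕ} (h : M ≤ K) : C M K * (C M K)ᴴ = 1 := by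
  ext i j
  simp only [C, Matrix.mul_apply, conjTranspose_apply, of_apply, apply_ite star, star_one,
    star_zero, Matrix.one_apply, Fin.ext_iff]
  exact sum_indicator_mul (by omega) _

theorem C_mul_Vc2 {M K : ℕ} (h : M ≤ K) : C M K * Vc2 M K = 0 := by
  ext i j
  simp only [C, Vc2, Matrix.mul_apply, of_apply, Matrix.zero_apply]
  rw [sum_indicator_mul (by omega), if_neg (by omega)]

theorem C_Vc2_complete {M K : ℕ} (h : M ≤ K) :
    (C M K)ᴴ * C M K + Vc2 M K * (Vc2 M K)ᴴ = 1 := by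
  ext i j
  simp only [Matrix.add_apply, Matrix.mul_apply, conjTranspose_apply, C, Vc2, of_apply,
    Matrix.one_apply, apply_ite star, star_one, star_zero]
  by_cases hi : i.val < M
  · rw [Finset.sum_eq_single_of_mem (⟨i, hi⟩ : Fin M) (Finset.mem_univ _), Finset.sum_eq_zero]
    · simp [Fin.ext_iff, eq_comm]
    · intro x _
      rw [if_neg (by omega), zero_mul]
    · intro x _ hx
      have : i.val ≠ x.val := fun h => hx (Fin.ext h.symm)
      simp [this]
  · rw [Finset.sum_eq_zero, Finset.sum_eq_single_of_mem (⟨i - M, by omega⟩ : Fin (K - M))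
      (Finset.mem_univ _)]
    · have e : M + (i.val - M) = i.val := by omega
      simp [e, Fin.ext_iff, eq_comm]
    · intro x _ hx
      have : ¬ i.val = M + x.val := fun h => hx (Fin.ext (by simp; omega))
      simp [this]
    · intro x _
      rw [if_neg (by omega), zero_mul]

theorem proj_C {M K : ℕ} (h : M ≤ K) : proj (C M K)ᴴ = (C M K)ᴴ * C M K := by
  rw [proj, conjTranspose_conjTranspose, C_orthonormal h, inv_one, Matrix.mul_one]

/-! ### Trace statistics -/

variable {N K M t r : ℕ}

/-- `Tr[(Z C†)† (Q_A - Q_{E_t}) (Z C†)]`, with `Q_X = R⁻¹ X (X† R⁻¹ X)⁻¹ X† R⁻¹`. -/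
theorem knownCovTrace_eq (hMK : M ≤ K) {R : Matrix (Fin N) (Fin N) ℂ} (hR : R.PosDef)
    (Z : Matrix (Fin N) (Fin K) ℂ) :
    knownCovTrace M t r R Z = trace ((Z * (C M K)ᴴ)ᴴ *
      (wproj (A N t r) R⁻¹ - wproj (Et N t) R⁻¹) * (Z * (C M K)ᴴ)) := by
  rw [← invSqrt_proj hR, ← invSqrt_proj hR, knownCovTrace, proj_C hMK, ← Matrix.mul_assoc,
    Matrix.trace_mul_comm, conjTranspose_mul, conjTranspose_conjTranspose]
  simp only [Matrix.mul_sub, Matrix.sub_mul, Matrix.mul_assoc]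

theorem waldTrace_eq (Z : Matrix (Fin N) (Fin K) ℂ) :
    waldTrace M t r Z = knownCovTrace M t r (Sc M Z) Z := by
  rw [waldTrace, knownCovTrace, ZW1, A1, A0, conjTranspose_mul, (invSqrt_isHermitian _).eq]
  simp only [Matrix.mul_assoc]

theorem trace_conjTranspose_mul_mul_im {n k : Type*} [Fintype n] [Fintype k] {Q : Matrix n n ℂ}
    (hQ : Q.IsHermitian) (Y : Matrix n k ℂ) : (trace (Yᴴ * Q * Y)).im = 0 := by
  have h : star (trace (Yᴴ * Q * Y)) = trace (Yᴴ * Q * Y) := by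
    rw [← trace_conjTranspose]
    simp only [conjTranspose_mul, conjTranspose_conjTranspose, hQ.eq, Matrix.mul_assoc]
  exact Complex.conj_eq_iff_im.1 h

theorem knownCovTrace_im (hMK : M ≤ K) {R : Matrix (Fin N) (Fin N) ℂ} (hR : R.PosDef)
    (Z : Matrix (Fin N) (Fin K) ℂ) : (knownCovTrace M t r R Z).im = 0 := by
  rw [knownCovTrace_eq hMK hR]
  exact trace_conjTranspose_mul_mul_im
    ((wproj_isHermitian hR.inv.isHermitian).sub (wproj_isHermitian hR.inv.isHermitian)) _

/-! ### Splitting the likelihood into primary and secondary data -/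

/-- Inserting the resolution of the identity `C† C + V V† = 1` between the two residuals separates
the primary columns from the secondary ones, on which the mean is zero. -/
theorem residual_gram (hMK : M ≤ K) {m : Type*} [Fintype m] (X : Matrix (Fin N) m ℂ)
    (B : Matrix m (Fin M) ℂ)
    (Z : Matrix (Fin N) (Fin K) ℂ) :
    (Z - X * B * C M K) * (Z - X * B * C M K)ᴴ =
      Sc M Z + (Z * (C M K)ᴴ - X * B) * (Z * (C M K)ᴴ - X * B)ᴴ := by
  set Y := Z - X * B * C M K
  have h1 : Y * (C M K)ᴴ = Z * (C M K)ᴴ - X * B := by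
    simp only [Y, Matrix.sub_mul, Matrix.mul_assoc, C_orthonormal hMK, Matrix.mul_one]
  have h2 : Y * Vc2 M K = secondary M Z := by
    simp only [Y, Matrix.sub_mul, Matrix.mul_assoc, C_mul_Vc2 hMK, Matrix.mul_zero, sub_zero,
      secondary]
  calc Y * Yᴴ = Y * ((C M K)ᴴ * C M K + Vc2 M K * (Vc2 M K)ᴴ) * Yᴴ := by
        rw [C_Vc2_complete hMK, Matrix.mul_one]
    _ = (Y * Vc2 M K) * (Y * Vc2 M K)ᴴ + (Y * (C M K)ᴴ) * (Y * (C M K)ᴴ)ᴴ := by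
        simp only [conjTranspose_mul, conjTranspose_conjTranspose, Matrix.mul_add, Matrix.add_mul,
          Matrix.mul_assoc]
        rw [add_comm]
    _ = _ := by rw [h1, h2, Sc]

/-- The factor of the likelihood that does not depend on the mean. -/
def pdfConst (M : ℕ) (R : Matrix (Fin N) (Fin N) ℂ) (Z : Matrix (Fin N) (Fin K) ℂ) : ℝ :=
  (Real.pi ^ (N * K))⁻¹ * (R.det.re ^ K)⁻¹ * Real.exp (-(trace (R⁻¹ * Sc M Z)).re)

theorem det_re_pos {n : Type*} [Fintype n] [DecidableEq n] {R : Matrix n n ℂ} (hR : R.PosDef) :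
    0 < R.det.re := (Complex.pos_iff.1 hR.det_pos).1

theorem pdfConst_pos {R : Matrix (Fin N) (Fin N) ℂ} (hR : R.PosDef)
    (Z : Matrix (Fin N) (Fin K) ℂ) : 0 < pdfConst M R Z := by
  have := det_re_pos hR
  have := Real.pi_pos
  unfold pdfConst
  positivity

theorem gaussianPdf_eq (hMK : M ≤ K) {m : Type*} [Fintype m] (X : Matrix (Fin N) m ℂ)
    (B : Matrix m (Fin M) ℂ) (R : Matrix (Fin N) (Fin N) ℂ) (Z : Matrix (Fin N) (Fin K) ℂ) :
    gaussianPdf (X * B * C M K) R Z = pdfConst M R Z *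
      Real.exp (-(trace ((Z * (C M K)ᴴ - X * B)ᴴ * R⁻¹ * (Z * (C M K)ᴴ - X * B))).re) := by
  rw [gaussianPdf, pdfConst, residual_gram hMK, Matrix.mul_add, trace_add, Complex.add_re, neg_add,
    Real.exp_add, ← Matrix.mul_assoc R⁻¹, Matrix.trace_mul_comm (R⁻¹ * _), ← Matrix.mul_assoc]
  ring

theorem trace_sandwich_nonneg {n k : Type*} [Fintype n] [Fintype k] {Q : Matrix n n ℂ}
    (hQ : Q.PosSemidef) (Y : Matrix n k ℂ) : 0 ≤ (trace (Yᴴ * Q * Y)).re :=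
  (Complex.nonneg_iff.1 (hQ.conjTranspose_mul_mul_same Y).trace_nonneg).1

/-- Maximum of the Gaussian likelihood over the linear coefficients for known covariance. -/
theorem gaussianPdf_wls (hMK : M ≤ K) {m : Type*} [Fintype m] [DecidableEq m]
    {X : Matrix (Fin N) m ℂ} (hX : Xᴴ * X = 1) {R : Matrix (Fin N) (Fin N) ℂ} (hR : R.PosDef)
    (Z : Matrix (Fin N) (Fin K) ℂ) :
    gaussianPdf (X * wls X R⁻¹ (Z * (C M K)ᴴ) * C M K) R Z = pdfConst M R Z *
      Real.exp (-(trace ((Z * (C M K)ᴴ)ᴴ * (R⁻¹ - wproj X R⁻¹) * (Z * (C M K)ᴴ))).re) := by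
  rw [gaussianPdf_eq hMK, complete_square hX hR.inv]
  simp

theorem gaussianPdf_le_wls (hMK : M ≤ K) {m : Type*} [Fintype m] [DecidableEq m]
    {X : Matrix (Fin N) m ℂ} (hX : Xᴴ * X = 1) {R : Matrix (Fin N) (Fin N) ℂ} (hR : R.PosDef)
    (Z : Matrix (Fin N) (Fin K) ℂ) (B : Matrix m (Fin M) ℂ) :
    gaussianPdf (X * B * C M K) R Z ≤
      gaussianPdf (X * wls X R⁻¹ (Z * (C M K)ᴴ) * C M K) R Z := by
  rw [gaussianPdf_wls hMK hX hR, gaussianPdf_eq hMK, complete_square hX hR.inv]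
  refine mul_le_mul_of_nonneg_left (Real.exp_le_exp.2 ?_) (pdfConst_pos hR Z).le
  rw [trace_add, Complex.add_re]
  linarith [trace_sandwich_nonneg (gram_posDef hX hR.inv).posSemidef
    (B - wls X R⁻¹ (Z * (C M K)ᴴ))]

theorem iSup_eq_of_forall_le {ι : Type*} {f : ι → ℝ} {i : ι} (h : ∀ j, f j ≤ f i) :
    ⨆ j, f j = f i :=
  have : Nonempty ι := ⟨i⟩
  le_antisymm (ciSup_le h) (le_ciSup ⟨f i, by rintro _ ⟨j, rfl⟩; exact h j⟩ i)

/-- The two maxima share the factor `pdfConst` and the exponent `-Tr[Y† R⁻¹ Y]`; in the quotient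
only the difference of the projection kernels survives. -/
theorem log_glrKnown (htr : t + r ≤ N) (hMK : M ≤ K) {R : Matrix (Fin N) (Fin N) ℂ}
    (hR : R.PosDef) (Z : Matrix (Fin N) (Fin K) ℂ) :
    ((Real.log (glrKnown M t r R Z) : ℝ) : ℂ) = knownCovTrace M t r R Z := by
  have hA := A_orthonormal htr
  have hE := Et_orthonormal (N := N) (t := t) (by omega)
  have h1 : Real.log (glrKnown M t r R Z) = (knownCovTrace M t r R Z).re := by
    unfold glrKnown f1 f0
    rw [iSup_eq_of_forall_le (gaussianPdf_le_wls hMK hA hR Z),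
      iSup_eq_of_forall_le (gaussianPdf_le_wls hMK hE hR Z), gaussianPdf_wls hMK hA hR,
      gaussianPdf_wls hMK hE hR, mul_div_mul_left _ _ (pdfConst_pos hR Z).ne', ← Real.exp_sub,
      Real.log_exp, knownCovTrace_eq hMK hR]
    simp only [Matrix.mul_sub, Matrix.sub_mul, trace_sub, Complex.sub_re]
    ring
  rw [h1]
  exact Complex.ext (by simp) (by simp [knownCovTrace_im hMK hR])

/-! ### Log-determinant inequalities -/

section LogDet

variable {N : ℕ}

theorem det_eq_ofReal {n : Type*} [Fintype n] [DecidableEq n] {R : Matrix n n ℂ}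
    (hR : R.IsHermitian) : R.det = (R.det.re : ℂ) := by
  have h : star R.det = R.det := by rw [← det_conjTranspose, hR.eq]
  exact (Complex.conj_eq_iff_re.1 h).symm

/-- Sum `log x ≤ x - 1` over the eigenvalues. The scalar inequality is strict away from `1`, so
equality makes every eigenvalue `1`; this carries the uniqueness of the covariance estimate. -/
theorem log_det_le_trace_sub {n : Type*} [Fintype n] [DecidableEq n] {Y : Matrix n n ℂ}
    (hY : Y.PosDef) : Real.log Y.det.re ≤ Y.trace.re - Fintype.card n ∧
      (Real.log Y.det.re = Y.trace.re - Fintype.card n → Y = 1) := by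
  have hpos := hY.eigenvalues_pos
  set ev := hY.1.eigenvalues with hev
  have h1 : Y.det.re = ∏ i, ev i := by
    have : Y.det = ((∏ i, ev i : ℝ) : ℂ) := by
      rw [hY.1.det_eq_prod_eigenvalues, Complex.ofReal_prod]; rfl
    rw [this, Complex.ofReal_re]
  have h2 : Y.trace.re = ∑ i, ev i := by
    have : Y.trace = ((∑ i, ev i : ℝ) : ℂ) := by
      rw [hY.1.trace_eq_sum_eigenvalues, Complex.ofReal_sum]; rfl
    rw [this, Complex.ofReal_re]
  have h3 : Real.log Y.det.re = ∑ i, Real.log (ev i) := by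
    rw [h1, Real.log_prod fun i _ => (hpos i).ne']
  have h4 : Y.trace.re - Fintype.card n = ∑ i, (ev i - 1) := by
    rw [h2, Finset.sum_sub_distrib]; simp
  rw [h3, h4]
  have hle : ∀ i ∈ Finset.univ, Real.log (ev i) ≤ ev i - 1 := fun i _ =>
    Real.log_le_sub_one_of_pos (hpos i)
  refine ⟨Finset.sum_le_sum hle, fun heq => ?_⟩
  have h5 := (Finset.sum_eq_sum_iff_of_le hle).1 heq
  have h6 : ∀ i, ev i = 1 := fun i => by
    by_contra hne
    exact (Real.log_lt_sub_one_of_pos (hpos i) hne).ne (h5 i (Finset.mem_univ i))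
  have h7 : (diagonal (RCLike.ofReal ∘ hY.1.eigenvalues) : Matrix n n ℂ) = 1 := by
    rw [← diagonal_one]
    congr 1
    funext i
    simp [← hev, h6 i]
  rw [hY.1.spectral_theorem, h7, map_one]

theorem posDef_whiten {R T : Matrix (Fin N) (Fin N) ℂ} (hR : R.PosDef) (hT : T.PosDef) :
    (invSqrt R * T * invSqrt R).PosDef := by
  have hu : IsUnit (invSqrt R) := by
    have : IsUnit (invSqrt R * invSqrt R) := by rw [invSqrt_mul_invSqrt hR]; exact hR.inv.isUnit
    exact isUnit_of_mul_isUnit_left this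
  have h := (Matrix.IsUnit.posDef_star_left_conjugate_iff hu (x := T)).2 hT
  rwa [star_eq_conjTranspose, (invSqrt_isHermitian R).eq] at h

theorem trace_whiten {R : Matrix (Fin N) (Fin N) ℂ} (hR : R.PosDef) (T : Matrix (Fin N) (Fin N) ℂ) :
    trace (invSqrt R * T * invSqrt R) = trace (R⁻¹ * T) := by
  rw [Matrix.trace_mul_comm, ← Matrix.mul_assoc, invSqrt_mul_invSqrt hR]

theorem det_whiten {R T : Matrix (Fin N) (Fin N) ℂ} (hR : R.PosDef) (hT : T.PosDef) :
    (invSqrt R * T * invSqrt R).det.re = T.det.re / R.det.re := by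
  have h : (invSqrt R * T * invSqrt R).det = R.det⁻¹ * T.det := by
    rw [det_mul, det_mul, mul_right_comm, ← det_mul, invSqrt_mul_invSqrt hR, det_nonsing_inv,
      Ring.inverse_eq_inv']
  rw [h, det_eq_ofReal hR.1, det_eq_ofReal hT.1, ← Complex.ofReal_inv, ← Complex.ofReal_mul,
    Complex.ofReal_re]
  simp only [Complex.ofReal_re]
  ring

theorem eq_of_whiten_eq_one {R T : Matrix (Fin N) (Fin N) ℂ} (hR : R.PosDef)
    (h : invSqrt R * T * invSqrt R = 1) : T = R := by
  have hu : IsUnit (CFC.sqrt R).det := by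
    have h1 : IsUnit (CFC.sqrt R * CFC.sqrt R) := by rw [sqrt_mul_sqrt hR]; exact hR.isUnit
    exact (Matrix.isUnit_iff_isUnit_det _).1 (isUnit_of_mul_isUnit_left h1)
  calc T = CFC.sqrt R * (invSqrt R * T * invSqrt R) * CFC.sqrt R := by
        rw [invSqrt, Matrix.mul_assoc _ T, mul_nonsing_inv_cancel_left _ _ hu,
          nonsing_inv_mul_cancel_right _ _ hu]
    _ = R := by rw [h, Matrix.mul_one, sqrt_mul_sqrt hR]

theorem log_det_sub_log_det_le {R T : Matrix (Fin N) (Fin N) ℂ} (hR : R.PosDef) (hT : T.PosDef) :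
    Real.log T.det.re - Real.log R.det.re ≤ (trace (R⁻¹ * T)).re - N ∧
      (Real.log T.det.re - Real.log R.det.re = (trace (R⁻¹ * T)).re - N → T = R) := by
  have h := log_det_le_trace_sub (posDef_whiten hR hT)
  rw [trace_whiten hR, det_whiten hR hT, Fintype.card_fin,
    Real.log_div (det_re_pos hT).ne' (det_re_pos hR).ne'] at h
  exact ⟨h.1, fun e => eq_of_whiten_eq_one hR (h.2 e)⟩

/-- Compares `V` with `V + Δ` through the previous inequality: `Tr[(V + Δ)⁻¹ V] = N - Tr[(V + Δ)⁻¹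
Δ]`, and the last trace is nonnegative. Equality forces `V = V + Δ`. -/
theorem log_det_le_log_det_add {V Δ : Matrix (Fin N) (Fin N) ℂ} (hV : V.PosDef)
    (hΔ : Δ.PosSemidef) : Real.log V.det.re ≤ Real.log (V + Δ).det.re ∧
      (Real.log V.det.re = Real.log (V + Δ).det.re → Δ = 0) := by
  have hW : (V + Δ).PosDef := hV.add_posSemidef hΔ
  have h := log_det_sub_log_det_le hW hV
  have h1 : 0 ≤ (trace ((V + Δ)⁻¹ * Δ)).re := by
    rw [← trace_whiten hW]
    have := hΔ.conjTranspose_mul_mul_same (invSqrt (V + Δ))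
    rw [(invSqrt_isHermitian _).eq] at this
    exact (Complex.nonneg_iff.1 this.trace_nonneg).1
  have h2 : (trace ((V + Δ)⁻¹ * V)).re = N - (trace ((V + Δ)⁻¹ * Δ)).re := by
    have : (V + Δ)⁻¹ * V + (V + Δ)⁻¹ * Δ = 1 := by
      rw [← Matrix.mul_add, nonsing_inv_mul _ ((Matrix.isUnit_iff_isUnit_det _).1 hW.isUnit)]
    have := congrArg (fun X => (trace X).re) this
    simp [trace_add] at this
    linarith
  refine ⟨by linarith [h.1], fun e => ?_⟩
  have h3 := h.2 (le_antisymm h.1 (by linarith))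
  exact left_eq_add.1 h3

theorem eq_zero_of_sandwich {m k : Type*} [Fintype m] {Q : Matrix m m ℂ} (hQ : Q.PosDef)
    {Y : Matrix m k ℂ} (h : Yᴴ * Q * Y = 0) : Y = 0 := by
  ext i j
  by_contra hij
  have hne : (fun i => Y i j) ≠ 0 := fun h0 => hij (congrFun h0 i)
  refine (hQ.dotProduct_mulVec_pos hne).ne' ?_
  have := congrFun (congrFun h j) j
  rw [Matrix.mul_assoc] at this
  simpa [Matrix.mul_apply, dotProduct, mulVec] using this

theorem det_add_mul_conjTranspose {M : ℕ} {S : Matrix (Fin N) (Fin N) ℂ} (hS : S.PosDef)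
    (D : Matrix (Fin N) (Fin M) ℂ) :
    (S + D * Dᴴ).det = S.det * (1 + Dᴴ * S⁻¹ * D).det := by
  have h : S + D * Dᴴ = S * (1 + (S⁻¹ * D) * Dᴴ) := by
    rw [Matrix.mul_add, Matrix.mul_one, Matrix.mul_assoc, mul_nonsing_inv_cancel_left _ _
      ((Matrix.isUnit_iff_isUnit_det _).1 hS.isUnit)]
  rw [h, det_mul, det_one_add_mul_comm, Matrix.mul_assoc]

end LogDet

/-! ### Maximum likelihood estimation under `H₁` -/

section MLE

variable {N K M t r : ℕ}

/-- `S_c + (Z C† - A B_s)(Z C† - A B_s)†`. -/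
def residualCov (Z : Matrix (Fin N) (Fin K) ℂ) (Bs : Matrix (Fin t ⊕ Fin r) (Fin M) ℂ) :
    Matrix (Fin N) (Fin N) ℂ :=
  Sc M Z + (Z * (C M K)ᴴ - A N t r * Bs) * (Z * (C M K)ᴴ - A N t r * Bs)ᴴ

/-- The generalized least squares coefficients with weight `S_c⁻¹`. -/
def coefHat (M t r : ℕ) (Z : Matrix (Fin N) (Fin K) ℂ) : Matrix (Fin t ⊕ Fin r) (Fin M) ℂ :=
  wls (A N t r) (Sc M Z)⁻¹ (Z * (C M K)ᴴ)

/-- The maximum likelihood covariance `K⁻¹ (S_c + D D†)`, `D` being the least squares residual. -/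
def covHat (M t r : ℕ) (Z : Matrix (Fin N) (Fin K) ℂ) : Matrix (Fin N) (Fin N) ℂ :=
  (K : ℂ)⁻¹ • residualCov Z (coefHat M t r Z)

theorem residualCov_posDef {Z : Matrix (Fin N) (Fin K) ℂ} (hS : (Sc M Z).PosDef)
    (Bs : Matrix (Fin t ⊕ Fin r) (Fin M) ℂ) : (residualCov Z Bs).PosDef :=
  hS.add_posSemidef (posSemidef_self_mul_conjTranspose _)

theorem inv_smul_posDef {T : Matrix (Fin N) (Fin N) ℂ} (hK : 0 < K) (hT : T.PosDef) :
    ((K : ℂ)⁻¹ • T).PosDef := by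
  refine hT.smul ?_
  have : (0 : ℂ) < K := by exact_mod_cast hK
  exact inv_pos.2 this

theorem covHat_posDef (hK : 0 < K) {Z : Matrix (Fin N) (Fin K) ℂ} (hS : (Sc M Z).PosDef) :
    (covHat M t r Z).PosDef :=
  inv_smul_posDef hK (residualCov_posDef hS _)

theorem log_f1 (hMK : M ≤ K) {R : Matrix (Fin N) (Fin N) ℂ} (hR : R.PosDef)
    (Z : Matrix (Fin N) (Fin K) ℂ) (Bs : Matrix (Fin t ⊕ Fin r) (Fin M) ℂ) :
    Real.log (f1 Z Bs R) = -Real.log (Real.pi ^ (N * K)) - K * Real.log R.det.re -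
      (trace (R⁻¹ * residualCov Z Bs)).re := by
  have h1 := (det_re_pos hR).ne'
  have h2 := Real.pi_pos.ne'
  rw [f1, gaussianPdf, residual_gram hMK, ← residualCov,
    Real.log_mul (by positivity) (by positivity), Real.log_mul (by positivity) (by positivity),
    Real.log_inv, Real.log_inv, Real.log_pow,
    Real.log_pow, Real.log_exp]
  ring

theorem f1_pos {R : Matrix (Fin N) (Fin N) ℂ} (hR : R.PosDef)
    (Z : Matrix (Fin N) (Fin K) ℂ) (Bs : Matrix (Fin t ⊕ Fin r) (Fin M) ℂ) : 0 < f1 Z Bs R := by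
  have h1 := (det_re_pos hR)
  have h2 := Real.pi_pos
  unfold f1 gaussianPdf
  positivity

/-- Profiling out the covariance: up to constants the log-likelihood is `-K (log det R + Tr[R⁻¹ T])`
with `T` the normalized residual, so the log-determinant inequality for the pair `(R, T)` applies,
with its equality case. -/
theorem log_f1_le (hMK : M ≤ K) (hK : 0 < K) {R : Matrix (Fin N) (Fin N) ℂ} (hR : R.PosDef)
    {Z : Matrix (Fin N) (Fin K) ℂ} (hS : (Sc M Z).PosDef)
    (Bs : Matrix (Fin t ⊕ Fin r) (Fin M) ℂ) :
    Real.log (f1 Z Bs R) ≤ Real.log (f1 Z Bs ((K : ℂ)⁻¹ • residualCov Z Bs)) ∧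
      (Real.log (f1 Z Bs R) = Real.log (f1 Z Bs ((K : ℂ)⁻¹ • residualCov Z Bs)) →
        R = (K : ℂ)⁻¹ • residualCov Z Bs) := by
  have hT := inv_smul_posDef hK (residualCov_posDef hS Bs)
  set T := (K : ℂ)⁻¹ • residualCov Z Bs with hTdef
  have hK0 : (K : ℂ) ≠ 0 := by exact_mod_cast hK.ne'
  have hres : residualCov Z Bs = (K : ℂ) • T := by
    rw [hTdef, smul_smul, mul_inv_cancel₀ hK0, one_smul]
  have htr : ∀ Q : Matrix (Fin N) (Fin N) ℂ,
      (trace (Q * residualCov Z Bs)).re = K * (trace (Q * T)).re := fun Q => by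
    rw [hres, Matrix.mul_smul, trace_smul, smul_eq_mul]
    simp
  have hTT : (trace (T⁻¹ * T)).re = N := by
    rw [nonsing_inv_mul _ ((Matrix.isUnit_iff_isUnit_det _).1 hT.isUnit)]; simp
  have h := log_det_sub_log_det_le hR hT
  rw [log_f1 hMK hR, log_f1 hMK hT, htr, htr, hTT]
  have hK' : (0 : ℝ) < K := by exact_mod_cast hK
  refine ⟨by nlinarith [h.1], fun e => (h.2 ?_).symm⟩
  have : (K : ℝ) * (Real.log T.det.re - Real.log R.det.re) = K * ((trace (R⁻¹ * T)).re - N) := by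
    linarith
  exact mul_left_cancel₀ hK'.ne' this

/-- Sylvester's identity rewrites the determinant as `det S_c` times that of `1 + D† S_c⁻¹ D`.
Completing the square makes the latter a fixed `V` plus a positive semidefinite term in `B -
coefHat`, which vanishes only at `B = coefHat`. -/
theorem log_det_residualCov_le (htr : t + r ≤ N) {Z : Matrix (Fin N) (Fin K) ℂ}
    (hS : (Sc M Z).PosDef) (Bs : Matrix (Fin t ⊕ Fin r) (Fin M) ℂ) :
    Real.log (residualCov Z (coefHat M t r Z)).det.re ≤ Real.log (residualCov Z Bs).det.re ∧
      (Real.log (residualCov Z (coefHat M t r Z)).det.re = Real.log (residualCov Z Bs).det.re →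
        Bs = coefHat M t r Z) := by
  have hA := A_orthonormal htr
  set Y := Z * (C M K)ᴴ with hY
  set V := (1 + Yᴴ * ((Sc M Z)⁻¹ - wproj (A N t r) (Sc M Z)⁻¹) * Y) with hVdef
  have hform : ∀ B : Matrix (Fin t ⊕ Fin r) (Fin M) ℂ, 1 + (Y - A N t r * B)ᴴ * (Sc M Z)⁻¹ *
      (Y - A N t r * B) = V + (B - coefHat M t r Z)ᴴ * ((A N t r)ᴴ * (Sc M Z)⁻¹ * A N t r) *
        (B - coefHat M t r Z) := fun B => by
    rw [complete_square hA hS.inv, hVdef, coefHat, ← hY, add_assoc]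
  have hVeq : 1 + (Y - A N t r * coefHat M t r Z)ᴴ * (Sc M Z)⁻¹ *
      (Y - A N t r * coefHat M t r Z) = V := by rw [hform]; simp
  have hpd : ∀ B : Matrix (Fin t ⊕ Fin r) (Fin M) ℂ, (1 + (Y - A N t r * B)ᴴ * (Sc M Z)⁻¹ *
      (Y - A N t r * B)).PosDef := fun B =>
    PosDef.one.add_posSemidef (hS.inv.posSemidef.conjTranspose_mul_mul_same _)
  have hV : V.PosDef := hVeq ▸ hpd _
  have hdet : ∀ B : Matrix (Fin t ⊕ Fin r) (Fin M) ℂ, Real.log (residualCov Z B).det.re =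
      Real.log (Sc M Z).det.re + Real.log (1 + (Y - A N t r * B)ᴴ * (Sc M Z)⁻¹ *
        (Y - A N t r * B)).det.re := fun B => by
    rw [residualCov, det_add_mul_conjTranspose hS, det_eq_ofReal hS.1, ← hY,
      det_eq_ofReal (hpd B).1, ← Complex.ofReal_mul, Complex.ofReal_re,
      Real.log_mul (det_re_pos hS).ne' (det_re_pos (hpd B)).ne']
    simp
  have hG := gram_posDef hA hS.inv
  have h := log_det_le_log_det_add hV
    (hG.posSemidef.conjTranspose_mul_mul_same (Bs - coefHat M t r Z))
  rw [hdet, hdet, hVeq, hform]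
  exact ⟨by linarith [h.1], fun e =>
    sub_eq_zero.1 (eq_zero_of_sandwich hG (h.2 (by linarith)))⟩

theorem log_f1_profile (hMK : M ≤ K) (hK : 0 < K) {Z : Matrix (Fin N) (Fin K) ℂ}
    (hS : (Sc M Z).PosDef) (Bs : Matrix (Fin t ⊕ Fin r) (Fin M) ℂ) :
    Real.log (f1 Z Bs ((K : ℂ)⁻¹ • residualCov Z Bs)) =
      -Real.log (Real.pi ^ (N * K)) + K * (N * Real.log K) - K * N -
        K * Real.log (residualCov Z Bs).det.re := by
  have hR := residualCov_posDef hS Bs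
  have hT := inv_smul_posDef hK hR
  have hK0 : (K : ℂ) ≠ 0 := by exact_mod_cast hK.ne'
  have hK' : (0 : ℝ) < K := by exact_mod_cast hK
  rw [log_f1 hMK hT]
  have h1 : (((K : ℂ)⁻¹ • residualCov Z Bs)⁻¹ * residualCov Z Bs) = (K : ℂ) • 1 := by
    have e : residualCov Z Bs = (K : ℂ) • ((K : ℂ)⁻¹ • residualCov Z Bs) := by
      rw [smul_smul, mul_inv_cancel₀ hK0, one_smul]
    set T := (K : ℂ)⁻¹ • residualCov Z Bs
    rw [e, Matrix.mul_smul, nonsing_inv_mul _ ((Matrix.isUnit_iff_isUnit_det _).1 hT.isUnit)]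
  have h2 : ((K : ℂ)⁻¹ • residualCov Z Bs).det.re =
      ((K : ℝ)⁻¹) ^ N * (residualCov Z Bs).det.re := by
    rw [det_smul, Fintype.card_fin, det_eq_ofReal hR.1, ← Complex.ofReal_natCast,
      ← Complex.ofReal_inv, ← Complex.ofReal_pow, ← Complex.ofReal_mul, Complex.ofReal_re]
    simp
  rw [h1, h2, Real.log_mul (by positivity) (det_re_pos hR).ne',
    Real.log_pow (n := N), Real.log_inv, trace_smul, trace_one]
  simp
  ring

theorem isMLE1_iff (htr : t + r ≤ N) (hMK : M ≤ K) (hK : 0 < K) {Z : Matrix (Fin N) (Fin K) ℂ}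
    (hS : (Sc M Z).PosDef)
    (p : Matrix (Fin t ⊕ Fin r) (Fin M) ℂ × Matrix (Fin N) (Fin N) ℂ) :
    IsMLE1 Z p ↔ p = (coefHat M t r Z, covHat M t r Z) := by
  have hK' : (0 : ℝ) < K := by exact_mod_cast hK
  have hprof : ∀ Bs : Matrix (Fin t ⊕ Fin r) (Fin M) ℂ,
      Real.log (f1 Z Bs ((K : ℂ)⁻¹ • residualCov Z Bs)) ≤
        Real.log (f1 Z (coefHat M t r Z) (covHat M t r Z)) := fun Bs => by
    rw [covHat, log_f1_profile hMK hK hS, log_f1_profile hMK hK hS]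
    nlinarith [(log_det_residualCov_le htr hS Bs).1]
  constructor
  · rintro ⟨hp, hmax⟩
    have h1 := Real.log_le_log (f1_pos (covHat_posDef hK hS) Z _)
      (hmax (coefHat M t r Z) (covHat M t r Z) (covHat_posDef hK hS))
    have h2 := log_f1_le hMK hK hp hS p.1
    have h3 := hprof p.1
    have hR := h2.2 (le_antisymm h2.1 (h3.trans h1))
    have h4 : Real.log (f1 Z p.1 ((K : ℂ)⁻¹ • residualCov Z p.1)) =
        Real.log (f1 Z (coefHat M t r Z) (covHat M t r Z)) := le_antisymm h3 (h1.trans h2.1)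
    rw [covHat, log_f1_profile hMK hK hS, log_f1_profile hMK hK hS] at h4
    have hB := (log_det_residualCov_le htr hS p.1).2
      (mul_left_cancel₀ hK'.ne' (by linarith))
    exact Prod.ext hB (by rw [hR, hB]; rfl)
  · rintro rfl
    refine ⟨covHat_posDef hK hS, fun Bs R hR => ?_⟩
    rw [← Real.log_le_log_iff (f1_pos hR _ _) (f1_pos (covHat_posDef hK hS) _ _)]
    exact (log_f1_le hMK hK hR hS Bs).1.trans (hprof Bs)

theorem mle1_eq (htr : t + r ≤ N) (hMK : M ≤ K) (hK : 0 < K) {Z : Matrix (Fin N) (Fin K) ℂ}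
    (hS : (Sc M Z).PosDef) : mle1 M t r Z = (coefHat M t r Z, covHat M t r Z) := by
  have h : ∃ p : Matrix (Fin t ⊕ Fin r) (Fin M) ℂ × Matrix (Fin N) (Fin N) ℂ, IsMLE1 Z p :=
    ⟨_, (isMLE1_iff htr hMK hK hS _).2 rfl⟩
  rw [mle1, dif_pos h]
  exact (isMLE1_iff htr hMK hK hS _).1 h.choose_spec

end MLE

/-! ### Complex Gaussian laws -/

section Gaussian

variable {N K : ℕ}

instance isAddHaarMeasure_volume :
    (volume : Measure (Fin N → Fin K → ℂ)).IsAddHaarMeasure :=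
  Measure.instIsAddHaarMeasureForallVolumeOfMeasurableAddOfSigmaFinite

/-- Sum of the squared moduli of the entries. -/
def sumSq (g : Fin N → Fin K → ℂ) : ℝ := ∑ i, ∑ j, ‖g i j‖ ^ 2

theorem sumSq_nonneg (g : Fin N → Fin K → ℂ) : 0 ≤ sumSq g :=
  Finset.sum_nonneg fun _ _ => Finset.sum_nonneg fun _ _ => by positivity

theorem trace_mul_conjTranspose_re (g : Fin N → Fin K → ℂ) :
    (trace (of g * (of g)ᴴ)).re = sumSq g := by
  simp only [trace, Matrix.mul_apply, sumSq, conjTranspose_apply, diag_apply, of_apply,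
    Complex.re_sum, ← starRingEnd_apply, Complex.mul_conj, Complex.ofReal_re,
    Complex.normSq_eq_norm_sq]

theorem exp_neg_mul_sumSq (b : ℝ) (g : Fin N → Fin K → ℂ) :
    Real.exp (-b * sumSq g) = ∏ i, ∏ j, Real.exp (-b * ‖g i j‖ ^ 2) := by
  simp only [sumSq, Finset.mul_sum, Real.exp_sum]

theorem integral_exp_neg_mul_sumSq {b : ℝ} (hb : 0 < b) :
    ∫ g : Fin N → Fin K → ℂ, Real.exp (-b * sumSq g) = (Real.pi / b) ^ (N * K) := by
  have h1 : ∫ z : ℂ, Real.exp (-b * ‖z‖ ^ 2) = Real.pi / b := by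
    have := GaussianFourier.integral_rexp_neg_mul_sq_norm (V := ℂ) hb
    simpa using this
  simp only [exp_neg_mul_sumSq]
  rw [integral_fintype_prod_volume_eq_pow
    (fun x : Fin K → ℂ => ∏ j, Real.exp (-b * ‖x j‖ ^ 2)),
    integral_fintype_prod_volume_eq_pow (fun z : ℂ => Real.exp (-b * ‖z‖ ^ 2)), h1,
    Fintype.card_fin, Fintype.card_fin, ← pow_mul, mul_comm]

theorem integrable_exp_neg_mul_sumSq {b : ℝ} (hb : 0 < b) :
    Integrable (fun g : Fin N → Fin K → ℂ => Real.exp (-b * sumSq g)) := by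
  -- The integral of a nonintegrable function is `0` by convention, so a nonzero value proves
  -- integrability.
  refine Integrable.of_integral_ne_zero ?_
  rw [integral_exp_neg_mul_sumSq hb]
  have := Real.pi_pos
  positivity

/-- The complex Gaussian law with mean `X` and independent columns of covariance `R`. -/
def gaussLaw (X : Matrix (Fin N) (Fin K) ℂ) (R : Matrix (Fin N) (Fin N) ℂ) :
    Measure (Fin N → Fin K → ℂ) :=
  volume.withDensity fun z => ENNReal.ofReal (gaussianPdf X R (of z))

theorem gaussianPdf_std (g : Fin N → Fin K → ℂ) :
    gaussianPdf 0 1 (of g) = (Real.pi ^ (N * K))⁻¹ * Real.exp (-sumSq g) := by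
  simp [gaussianPdf, trace_mul_conjTranspose_re]

theorem continuous_gaussianPdf (X : Matrix (Fin N) (Fin K) ℂ) (R : Matrix (Fin N) (Fin N) ℂ) :
    Continuous fun z : Fin N → Fin K → ℂ => gaussianPdf X R (of z) := by
  have h : Continuous fun z : Fin N → Fin K → ℂ => of z - X :=
    (continuous_id (X := Fin N → Fin K → ℂ)).sub continuous_const
  unfold gaussianPdf
  refine continuous_const.mul (Real.continuous_exp.comp (Continuous.neg ?_))
  exact Complex.continuous_re.comp
    (Continuous.matrix_trace (continuous_const.matrix_mul (h.matrix_mul h.matrix_conjTranspose)))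

/-- Left multiplication by `L` as a complex linear map on data arrays. -/
def mulLeftC (K : ℕ) (L : Matrix (Fin N) (Fin N) ℂ) :
    (Fin N → Fin K → ℂ) →ₗ[ℂ] (Fin N → Fin K → ℂ) where
  toFun g := L * of g
  map_add' g g' := Matrix.mul_add L (of g) (of g')
  map_smul' c g := Matrix.mul_smul L c (of g)

/-- `L` acts on each of the `K` columns separately; transposing the array exhibits the map as a
product of `K` copies of `L`. -/
theorem det_mulLeftC (L : Matrix (Fin N) (Fin N) ℂ) : LinearMap.det (mulLeftC K L) = L.det ^ K := by
  let e : (Fin N → Fin K → ℂ) ≃ₗ[ℂ] (Fin K → Fin N → ℂ) :=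
    { toFun := fun g j i => g i j
      invFun := fun g i j => g j i
      map_add' := fun _ _ => rfl
      map_smul' := fun _ _ => rfl
      left_inv := fun _ => rfl
      right_inv := fun _ => rfl }
  have h : (e : (Fin N → Fin K → ℂ) →ₗ[ℂ] (Fin K → Fin N → ℂ)) ∘ₗ mulLeftC K L ∘ₗ
      (e.symm : (Fin K → Fin N → ℂ) →ₗ[ℂ] (Fin N → Fin K → ℂ)) =
      LinearMap.pi fun i => (Matrix.toLin' L).comp (LinearMap.proj i) := by
    ext i x j k
    rfl
  rw [← LinearMap.det_conj (mulLeftC K L) e, h, LinearMap.det_pi]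
  simp

theorem det_mulLeft_real (L : Matrix (Fin N) (Fin N) ℂ) :
    LinearMap.det ((mulLeftC K L).restrictScalars ℝ) = (Complex.normSq L.det) ^ K := by
  rw [LinearMap.det_restrictScalars, det_mulLeftC, Algebra.norm_complex_apply, map_pow]

/-- The affine change of variables `g ↦ L g + X`. -/
def affineEquiv (L : Matrix (Fin N) (Fin N) ℂ) (hL : IsUnit L.det) (X : Matrix (Fin N) (Fin K) ℂ) :
    (Fin N → Fin K → ℂ) ≃ᵐ (Fin N → Fin K → ℂ) where
  toFun g := L * of g + X
  invFun z := L⁻¹ * (of z - X)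
  left_inv g := by
    change L⁻¹ * (L * of g + X - X) = of g
    rw [add_sub_cancel_right, nonsing_inv_mul_cancel_left _ _ hL]
  right_inv z := by
    change L * (L⁻¹ * (of z - X)) + X = of z
    rw [mul_nonsing_inv_cancel_left _ _ hL, sub_add_cancel]
  measurable_toFun := by
    have h : Continuous fun g : Fin N → Fin K → ℂ => L * of g + X :=
      (continuous_const.matrix_mul (continuous_id (X := Fin N → Fin K → ℂ))).add continuous_const
    exact Continuous.measurable (γ := Fin N → Fin K → ℂ) h
  measurable_invFun := by
    have h : Continuous fun g : Fin N → Fin K → ℂ => L⁻¹ * (of g - X) :=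
      continuous_const.matrix_mul ((continuous_id (X := Fin N → Fin K → ℂ)).sub continuous_const)
    exact Continuous.measurable (γ := Fin N → Fin K → ℂ) h

theorem map_affineEquiv_volume (L : Matrix (Fin N) (Fin N) ℂ) (hL : IsUnit L.det)
    (X : Matrix (Fin N) (Fin K) ℂ) :
    (volume : Measure (Fin N → Fin K → ℂ)).map (affineEquiv L hL X) =
      ENNReal.ofReal ((Complex.normSq L.det ^ K)⁻¹) • volume := by
  have hd : 0 < Complex.normSq L.det := Complex.normSq_pos.2 hL.ne_zero
  have hf : LinearMap.det ((mulLeftC K L).restrictScalars ℝ) ≠ 0 := by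
    rw [det_mulLeft_real]; positivity
  let X' : Fin N → Fin K → ℂ := X
  have hX : Measurable fun g : Fin N → Fin K → ℂ => g + X' := measurable_id.add_const _
  have hl : Measurable ((mulLeftC K L).restrictScalars ℝ) :=
    (LinearMap.continuous_of_finiteDimensional _).measurable
  have h : (affineEquiv L hL X : (Fin N → Fin K → ℂ) → (Fin N → Fin K → ℂ)) =
      (fun g : Fin N → Fin K → ℂ => g + X') ∘ (mulLeftC K L).restrictScalars ℝ := rfl
  rw [h, ← Measure.map_map hX hl, Measure.map_linearMap_addHaar_eq_smul_addHaar volume hf,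
    Measure.map_smul, map_add_right_eq_self, det_mulLeft_real, abs_of_pos (by positivity)]

theorem gaussianPdf_affine {L : Matrix (Fin N) (Fin N) ℂ} (hL : IsUnit L.det)
    (X : Matrix (Fin N) (Fin K) ℂ) (g : Fin N → Fin K → ℂ) :
    gaussianPdf 0 1 (of g) =
      Complex.normSq L.det ^ K * gaussianPdf X (L * Lᴴ) (of (affineEquiv L hL X g)) := by
  have hd : 0 < Complex.normSq L.det := Complex.normSq_pos.2 hL.ne_zero
  have h0 : of (affineEquiv L hL X g) = L * of g + X := rfl
  have h1 : (L * Lᴴ).det.re = Complex.normSq L.det := by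
    rw [det_mul, det_conjTranspose, ← starRingEnd_apply, Complex.mul_conj, Complex.ofReal_re]
  have h2 : trace ((L * Lᴴ)⁻¹ * (L * of g * (L * of g)ᴴ)) = trace (of g * (of g)ᴴ) := by
    have hLH : IsUnit (Lᴴ).det := by rw [det_conjTranspose]; exact hL.star
    rw [Matrix.mul_inv_rev, conjTranspose_mul, Matrix.mul_assoc, Matrix.mul_assoc L,
      nonsing_inv_mul_cancel_left _ _ hL, ← Matrix.mul_assoc (of g), Matrix.trace_mul_comm,
      Matrix.mul_assoc, mul_nonsing_inv _ hLH, Matrix.mul_one]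
  rw [gaussianPdf_std, gaussianPdf, h0, add_sub_cancel_right, h1, h2, trace_mul_conjTranspose_re]
  field_simp

/-- The real Jacobian `|det L|^(2K)` of `g ↦ L g + X` cancels the factor `det(L L†)^(-K)` of the
density. All later computations are thereby reduced to standard noise. -/
theorem gaussLaw_eq_map {L : Matrix (Fin N) (Fin N) ℂ} (hL : IsUnit L.det)
    (X : Matrix (Fin N) (Fin K) ℂ) :
    gaussLaw X (L * Lᴴ) = (gaussLaw 0 1).map (affineEquiv L hL X) := by
  have hd : 0 < Complex.normSq L.det := Complex.normSq_pos.2 hL.ne_zero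
  set c : ℝ := Complex.normSq L.det ^ K with hc
  have hcpos : 0 < c := by positivity
  have hvol : (volume : Measure (Fin N → Fin K → ℂ)) =
      ENNReal.ofReal c • (volume : Measure (Fin N → Fin K → ℂ)).map (affineEquiv L hL X) := by
    rw [map_affineEquiv_volume, smul_smul, ← ENNReal.ofReal_mul hcpos.le,
      mul_inv_cancel₀ hcpos.ne', ENNReal.ofReal_one, one_smul]
  ext s hs
  rw [gaussLaw, withDensity_apply _ hs, MeasurableEquiv.map_apply, gaussLaw, withDensity_apply _
    ((affineEquiv L hL X).measurable hs)]
  conv_lhs => rw [hvol]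
  rw [Measure.restrict_smul, lintegral_smul_measure, MeasurableEquiv.restrict_map,
    lintegral_map_equiv, smul_eq_mul, ← lintegral_const_mul' _ _ ENNReal.ofReal_ne_top]
  refine lintegral_congr fun g => ?_
  rw [gaussianPdf_affine hL X, ENNReal.ofReal_mul hcpos.le]

theorem exists_sqrt_factor {R : Matrix (Fin N) (Fin N) ℂ} (hR : R.PosDef) :
    ∃ L : Matrix (Fin N) (Fin N) ℂ, IsUnit L.det ∧ L * Lᴴ = R := by
  have h1 := sqrt_mul_sqrt hR
  refine ⟨CFC.sqrt R, ?_, by rw [(sqrt_isHermitian R).eq, h1]⟩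
  have h2 : IsUnit (CFC.sqrt R * CFC.sqrt R) := by rw [h1]; exact hR.isUnit
  exact (Matrix.isUnit_iff_isUnit_det _).1 (isUnit_of_mul_isUnit_left h2)

theorem gaussLaw_absolutelyContinuous (X : Matrix (Fin N) (Fin K) ℂ)
    (R : Matrix (Fin N) (Fin N) ℂ) : gaussLaw X R ≪ volume :=
  withDensity_absolutelyContinuous _ _

end Gaussian

/-! ### Almost sure positive definiteness of `S_c` -/

section AlmostSure

/-- A measurable set meeting every line of a given direction in a countable set is null. -/
theorem measure_zero_of_countable_lines {E : Type*} [NormedAddCommGroup E] [NormedSpace ℝ E]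
    [MeasurableSpace E] [BorelSpace E] [SecondCountableTopology E] (μ : Measure E) [SFinite μ]
    [μ.IsAddRightInvariant] {s : Set E} (hs : MeasurableSet s) (v : E)
    (h : ∀ x, {c : ℝ | x + c • v ∈ s}.Countable) : μ s = 0 := by
  have hm : MeasurableSet {p : E × ℝ | p.1 + p.2 • v ∈ s} :=
    hs.preimage (by fun_prop)
  -- Fubini in both orders: the slices along the line are countable, hence null, while each slice at
  -- fixed `c` is a translate of `s` and has measure `μ s`.
  have h1 : (μ.prod (volume.restrict (Set.Icc (0 : ℝ) 1))) {p : E × ℝ | p.1 + p.2 • v ∈ s} = 0 := by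
    rw [Measure.measure_prod_null hm]
    exact Filter.Eventually.of_forall fun x => (h x).measure_zero _
  rw [Measure.prod_apply_symm hm] at h1
  have h2 : ∀ c : ℝ, μ ((fun x => (x, c)) ⁻¹' {p : E × ℝ | p.1 + p.2 • v ∈ s}) = μ s := fun c =>
    measure_preimage_add_right μ (c • v) s
  simpa only [h2, lintegral_const, Measure.restrict_apply_univ, Real.volume_Icc, sub_zero,
    ENNReal.ofReal_one, mul_one] using h1

variable {N K M : ℕ}

/-- The first `N` secondary columns. -/
def secondarySquare (M : ℕ) (hK : M + N ≤ K) (z : Fin N → Fin K → ℂ) : Matrix (Fin N) (Fin N) ℂ :=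
  of fun i j => z i ⟨M + j.val, by omega⟩

theorem ae_det_secondarySquare_ne_zero (hK : M + N ≤ K) :
    ∀ᵐ z : Fin N → Fin K → ℂ, (secondarySquare M hK z).det ≠ 0 := by
  have hcont : Continuous fun z : Fin N → Fin K → ℂ => (secondarySquare M hK z).det := by
    refine Continuous.matrix_det ?_
    exact continuous_matrix fun i j => by
      change Continuous fun z : Fin N → Fin K → ℂ => z i _
      fun_prop
  rw [ae_iff]
  simp only [not_not]
  -- Moving along `v` subtracts `c` times the identity from the square block, so the determinant on
  -- each line is, up to sign, a characteristic polynomial and has finitely many zeros.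
  let v : Fin N → Fin K → ℂ := fun i k => if k.val = M + i.val then -1 else 0
  refine measure_zero_of_countable_lines volume
    (measurableSet_eq_fun hcont.measurable measurable_const) v fun x => ?_
  have hx : ∀ c : ℝ, (secondarySquare M hK (x + c • v)).det =
      (-1) ^ N * (secondarySquare M hK x).charpoly.eval (c : ℂ) := fun c => by
    have : secondarySquare M hK (x + c • v) =
        -(scalar (Fin N) (c : ℂ) - secondarySquare M hK x) := by
      ext i j
      by_cases hij : i = j
      · subst hij; simp [secondarySquare, v]; ring
      · have : ¬ j = i := fun h => hij h.symm
        simp [secondarySquare, v, hij, Fin.ext_iff.not.1 this]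
    rw [this, det_neg, Fintype.card_fin, eval_charpoly]
  have hfin : {c : ℂ | (secondarySquare M hK x).charpoly.eval c = 0}.Finite := by
    refine (Polynomial.finite_setOfPred_isRoot (charpoly_monic _).ne_zero)
  refine Set.Countable.mono (fun c hc => ?_) (hfin.countable.preimage Complex.ofReal_injective)
  have h0 : (secondarySquare M hK (x + c • v)).det = 0 := hc
  rw [hx] at h0
  exact (mul_eq_zero.1 h0).resolve_left (by simp)

theorem Sc_posDef_of_det_ne_zero (hK : M + N ≤ K) {z : Fin N → Fin K → ℂ}
    (h : (secondarySquare M hK z).det ≠ 0) : (Sc M (of z)).PosDef := by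
  refine PosDef.mul_conjTranspose_self _ ?_
  intro u w huw
  have hsec : ∀ (i : Fin N) (j : Fin N), secondary M (of z) i ⟨j.val, by omega⟩ =
      secondarySquare M hK z i j := fun i j => by
    simp only [secondary, Matrix.mul_apply, Vc2, of_apply, secondarySquare]
    rw [Finset.sum_eq_single_of_mem (⟨M + j.val, by omega⟩ : Fin K) (Finset.mem_univ _)]
    · simp
    · intro x _ hx
      have : ¬ x.val = M + j.val := fun h => hx (Fin.ext h)
      simp [this]
  have : u ᵥ* secondarySquare M hK z = w ᵥ* secondarySquare M hK z := by
    ext j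
    have := congrFun huw ⟨j.val, by omega⟩
    simpa [vecMul, dotProduct, hsec] using this
  exact vecMul_injective_of_isUnit ((Matrix.isUnit_iff_isUnit_det _).2 (isUnit_iff_ne_zero.2 h)) this

theorem ae_Sc_posDef (hK : M + N ≤ K) (X : Matrix (Fin N) (Fin K) ℂ)
    (R : Matrix (Fin N) (Fin N) ℂ) : ∀ᵐ z ∂gaussLaw X R, (Sc M (of z)).PosDef := by
  refine (gaussLaw_absolutelyContinuous X R).ae_le ?_
  filter_upwards [ae_det_secondarySquare_ne_zero hK] with z hz
  exact Sc_posDef_of_det_ne_zero hK hz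

end AlmostSure

/-! ### Invariance of the statistic and the CFAR property -/

section Invariance

variable {n m : Type*} [Fintype n] [Fintype m] [DecidableEq m]

/-- The kernel depends on `X` only through its column space. This is what lets `L X = X H` be
absorbed. -/
theorem wproj_mul_right {H : Matrix m m ℂ} (hH : IsUnit H.det) (X : Matrix n m ℂ)
    (G : Matrix n n ℂ) : wproj (X * H) G = wproj X G := by
  have hH' : IsUnit (Hᴴ).det := by rw [det_conjTranspose]; exact hH.star
  have h : (X * H)ᴴ * G * (X * H) = Hᴴ * ((Xᴴ * G * X) * H) := by
    simp only [conjTranspose_mul, Matrix.mul_assoc]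
  rw [wproj, h, Matrix.mul_inv_rev, Matrix.mul_inv_rev, conjTranspose_mul, wproj]
  simp only [Matrix.mul_assoc]
  rw [mul_nonsing_inv_cancel_left _ _ hH, nonsing_inv_mul_cancel_left _ _ hH']

variable [DecidableEq n]

theorem wproj_mul_left {L : Matrix n n ℂ} (hL : IsUnit L.det) (X : Matrix n m ℂ)
    (S : Matrix n n ℂ) : wproj (L * X) (L * S * Lᴴ)⁻¹ = (L⁻¹)ᴴ * wproj X S⁻¹ * L⁻¹ := by
  have hL' : IsUnit (Lᴴ).det := by rw [det_conjTranspose]; exact hL.star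
  have h : (L * X)ᴴ * (L * S * Lᴴ)⁻¹ * (L * X) = Xᴴ * S⁻¹ * X := by
    simp only [conjTranspose_mul, Matrix.mul_inv_rev, Matrix.mul_assoc]
    rw [nonsing_inv_mul_cancel_left _ _ hL, mul_nonsing_inv_cancel_left _ _ hL']
  rw [wproj, h, wproj, conjTranspose_mul, conjTranspose_nonsing_inv]
  simp only [Matrix.mul_inv_rev, Matrix.mul_assoc]
  rw [nonsing_inv_mul_cancel_left _ _ hL, mul_nonsing_inv_cancel_left _ _ hL']

theorem isUnit_det_of_mul_eq {L : Matrix n n ℂ} (hL : IsUnit L.det) {X : Matrix n m ℂ}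
    (hX : Xᴴ * X = 1) {H : Matrix m m ℂ} (h : L * X = X * H) : IsUnit H.det := by
  have : (Xᴴ * L⁻¹ * X) * H = 1 := by
    rw [Matrix.mul_assoc, ← h, Matrix.mul_assoc, nonsing_inv_mul_cancel_left _ _ hL, hX]
  exact isUnit_det_of_left_inverse this

/-- If `L` leaves the column space of `X` invariant, the weighted projection kernel is
equivariant. -/
theorem wproj_equivariant {L : Matrix n n ℂ} (hL : IsUnit L.det) {X : Matrix n m ℂ}
    (hX : Xᴴ * X = 1) {H : Matrix m m ℂ} (h : L * X = X * H) (S : Matrix n n ℂ) :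
    wproj X (L * S * Lᴴ)⁻¹ = (L⁻¹)ᴴ * wproj X S⁻¹ * L⁻¹ := by
  rw [← wproj_mul_left hL, h, wproj_mul_right (isUnit_det_of_mul_eq hL hX h)]

theorem mul_eq_mul_submatrix {L : Matrix n n ℂ} {X : Matrix n m ℂ} {e : m → n}
    (he : Function.Injective e) (hX : ∀ i a, X i a = if i = e a then 1 else 0)
    (hL : ∀ i, i ∉ Set.range e → ∀ b, L i (e b) = 0) : L * X = X * L.submatrix e e := by
  ext i b
  have h1 : (L * X) i b = L i (e b) := by simp [Matrix.mul_apply, hX]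
  rw [h1, Matrix.mul_apply]
  simp only [hX, submatrix_apply]
  by_cases hi : i ∈ Set.range e
  · obtain ⟨a, rfl⟩ := hi
    simp [he.eq_iff]
  · rw [hL i hi, Finset.sum_eq_zero]
    intro a _
    rw [if_neg (fun h => hi ⟨a, h.symm⟩), zero_mul]

end Invariance

/-! ### Triangular factors and the CFAR property -/

section CFAR

variable {N K M t r : ℕ}

/-- A positive definite matrix factors as `L L†` with `L` upper triangular. -/
theorem exists_upperTriangular_factor {R : Matrix (Fin N) (Fin N) ℂ} (hR : R.PosDef) :
    ∃ L : Matrix (Fin N) (Fin N) ℂ, IsUnit L.det ∧ L * Lᴴ = R ∧ ∀ i j, j < i → L i j = 0 := by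
  -- The factorization is applied to `R⁻¹`: from `Λ R⁻¹ Λ† = D` with `Λ` lower triangular one gets
  -- `R = Λ† D⁻¹ Λ`, whose left factor `Λ†` is upper triangular as required.
  set Λ := LDL.lowerInv hR.inv with hΛ
  have hΛu : IsUnit Λ.det := (Matrix.isUnit_iff_isUnit_det _).1 (isUnit_of_invertible _)
  have hΛu' : IsUnit (Λᴴ).det := by rw [det_conjTranspose]; exact hΛu.star
  set d := LDL.diagEntries hR.inv with hd
  have hD : diagonal d = Λ * R⁻¹ * Λᴴ := LDL.diag_eq_lowerInv_conj hR.inv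
  have hdpos : ∀ i, 0 < d i := by
    have hpd : (diagonal d).PosDef := by
      rw [hD]
      have := (Matrix.IsUnit.posDef_star_right_conjugate_iff
        ((Matrix.isUnit_iff_isUnit_det _).2 hΛu) (x := R⁻¹)).2 hR.inv
      exact this
    intro i
    simpa using hpd.diag_pos (i := i)
  have hdre : ∀ i, 0 < (d i).re := fun i => (Complex.pos_iff.1 (hdpos i)).1
  have hdeq : ∀ i, d i = ((d i).re : ℂ) := fun i =>
    Complex.ext (by simp) (by simpa using (Complex.pos_iff.1 (hdpos i)).2.symm)
  set s : Fin N → ℂ := fun i => (((Real.sqrt (d i).re)⁻¹ : ℝ) : ℂ) with hs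
  have hss : ∀ i, s i * star (s i) = (d i)⁻¹ := fun i => by
    have : star (s i) = s i := Complex.conj_ofReal _
    rw [this, hs, ← Complex.ofReal_mul, ← mul_inv, Real.mul_self_sqrt (hdre i).le,
      Complex.ofReal_inv, ← hdeq]
  have hfac : (Λᴴ * diagonal s) * (Λᴴ * diagonal s)ᴴ = R := by
    have h1 : diagonal s * (diagonal s)ᴴ = (diagonal d)⁻¹ := by
      refine (inv_eq_right_inv ?_).symm
      rw [diagonal_conjTranspose, diagonal_mul_diagonal, diagonal_mul_diagonal, ← diagonal_one]
      congr 1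
      funext i
      rw [Pi.star_apply, hss, mul_inv_cancel₀ (hdpos i).ne']
    have hRR : R⁻¹⁻¹ = R := nonsing_inv_nonsing_inv _ ((Matrix.isUnit_iff_isUnit_det _).1 hR.isUnit)
    rw [conjTranspose_mul, conjTranspose_conjTranspose, Matrix.mul_assoc, ← Matrix.mul_assoc _ _ Λ,
      h1, hD, Matrix.mul_inv_rev, Matrix.mul_inv_rev, hRR, Matrix.mul_assoc, Matrix.mul_assoc,
      nonsing_inv_mul _ hΛu, Matrix.mul_one, mul_nonsing_inv_cancel_left _ _ hΛu']
  refine ⟨Λᴴ * diagonal s, ?_, hfac, fun i j hij => ?_⟩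
  · have h2 : IsUnit ((Λᴴ * diagonal s) * (Λᴴ * diagonal s)ᴴ) := by rw [hfac]; exact hR.isUnit
    exact (Matrix.isUnit_iff_isUnit_det _).1 (isUnit_of_mul_isUnit_left h2)
  · rw [mul_diagonal, conjTranspose_apply, hΛ, LDL.lowerInv_triangular hR.inv hij, star_zero,
      zero_mul]

/-- The columns of `Et` span the first `t` coordinates, and an upper triangular matrix preserves
every span of leading coordinates. The same holds for `A` and the first `t + r` coordinates. -/
theorem upperTriangular_mul_Et (ht : t ≤ N) {L : Matrix (Fin N) (Fin N) ℂ}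
    (hL : ∀ i j, j < i → L i j = 0) : ∃ H : Matrix (Fin t) (Fin t) ℂ, L * Et N t = Et N t * H := by
  refine ⟨_, mul_eq_mul_submatrix (e := fun a => ⟨a.val, a.2.trans_le ht⟩) ?_ ?_ ?_⟩
  · intro a b h; simpa [Fin.ext_iff] using h
  · intro i a; simp [Et, Fin.ext_iff]
  · intro i hi b
    refine hL _ _ (Fin.lt_def.2 ?_)
    by_contra hlt
    exact hi ⟨⟨i.val, by have := b.2; simp at hlt; omega⟩, rfl⟩

theorem upperTriangular_mul_A (htr : t + r ≤ N) {L : Matrix (Fin N) (Fin N) ℂ}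
    (hL : ∀ i j, j < i → L i j = 0) :
    ∃ H : Matrix (Fin t ⊕ Fin r) (Fin t ⊕ Fin r) ℂ, L * A N t r = A N t r * H := by
  refine ⟨_, mul_eq_mul_submatrix (e := Sum.elim (fun a => ⟨a.val, by omega⟩)
    fun b => ⟨t + b.val, by omega⟩) ?_ ?_ ?_⟩
  · rintro (a | a) (b | b) h <;> simp [Fin.ext_iff] at h ⊢ <;> omega
  · rintro i (a | a) <;> simp [A, Et, Er, Fin.ext_iff]
  · intro i hi b
    refine hL _ _ (Fin.lt_def.2 ?_)
    have hge : t + r ≤ i.val := by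
      by_contra hlt
      by_cases hit : i.val < t
      · exact hi ⟨.inl ⟨i.val, hit⟩, rfl⟩
      · exact hi ⟨.inr ⟨i.val - t, by omega⟩, Fin.ext (by simp; omega)⟩
    rcases b with b | b <;> simp <;> omega

/-- `S_c` becomes `L S_c L†`, and since `L` preserves both subspaces the kernels transform by the
inverse congruence, which cancels the action on the data. The added interference lies in the kernel
of `Q`. -/
theorem waldTrace_affine (htr : t + r ≤ N) (hMK : M ≤ K) {L : Matrix (Fin N) (Fin N) ℂ}
    (hL : IsUnit L.det) (hL' : ∀ i j, j < i → L i j = 0) (Bt : Matrix (Fin t) (Fin M) ℂ)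
    {Z : Matrix (Fin N) (Fin K) ℂ} (hS : (Sc M Z).PosDef) :
    (Sc M (L * Z + Et N t * Bt * C M K)).PosDef ∧
      waldTrace M t r (L * Z + Et N t * Bt * C M K) = waldTrace M t r Z := by
  have hA := A_orthonormal htr
  have hE := Et_orthonormal (N := N) (t := t) (by omega)
  obtain ⟨H, hH⟩ := upperTriangular_mul_A htr hL'
  obtain ⟨H', hH'⟩ := upperTriangular_mul_Et (t := t) (by omega) hL'
  have hH'u := isUnit_det_of_mul_eq hL hE hH'
  have hSc : Sc M (L * Z + Et N t * Bt * C M K) = L * Sc M Z * Lᴴ := by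
    have : secondary M (L * Z + Et N t * Bt * C M K) = L * secondary M Z := by
      rw [secondary, Matrix.add_mul, Matrix.mul_assoc _ (C M K), C_mul_Vc2 hMK, Matrix.mul_zero,
        add_zero, Matrix.mul_assoc, secondary]
    rw [Sc, this, conjTranspose_mul, Sc]
    simp only [Matrix.mul_assoc]
  have hS' : (L * Sc M Z * Lᴴ).PosDef :=
    (Matrix.IsUnit.posDef_star_right_conjugate_iff ((Matrix.isUnit_iff_isUnit_det _).2 hL)).2 hS
  refine ⟨hSc ▸ hS', ?_⟩
  rw [waldTrace_eq, waldTrace_eq, hSc, knownCovTrace_eq hMK hS', knownCovTrace_eq hMK hS,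
    wproj_equivariant hL hA hH, wproj_equivariant hL hE hH']
  set Q := wproj (A N t r) (Sc M Z)⁻¹ - wproj (Et N t) (Sc M Z)⁻¹ with hQ
  generalize hYdef : Z * (C M K)ᴴ = Y
  have hY : (L * Z + Et N t * Bt * C M K) * (C M K)ᴴ = L * (Y + Et N t * (H'⁻¹ * Bt)) := by
    rw [← hYdef, Matrix.add_mul, Matrix.mul_assoc _ (C M K), C_orthonormal hMK, Matrix.mul_one,
      Matrix.mul_add, ← Matrix.mul_assoc L (Et N t), hH', Matrix.mul_assoc (Et N t) H',
      mul_nonsing_inv_cancel_left _ _ hH'u, Matrix.mul_assoc]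
  -- The range of `E_t` lies in both column spaces, so both kernels act on it as `S_c⁻¹`.
  have hQE : Q * Et N t = 0 := by
    have h1 : wproj (Et N t) (Sc M Z)⁻¹ * Et N t = (Sc M Z)⁻¹ * Et N t := by
      have := wls_mul_self hE hS.inv (1 : Matrix (Fin t) (Fin t) ℂ)
      rw [Matrix.mul_one] at this
      rw [wproj_mul, this, Matrix.mul_one]
    have h2 : wproj (A N t r) (Sc M Z)⁻¹ * Et N t = (Sc M Z)⁻¹ * Et N t := by
      have h3 := A_mul_inl (N := N) (r := r) (1 : Matrix (Fin t) (Fin t) ℂ)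
      rw [Matrix.mul_one] at h3
      rw [← h3, wproj_mul, wls_mul_self hA hS.inv]
    rw [hQ, Matrix.sub_mul, h1, h2, sub_self]
  have hQh : Q.IsHermitian := (wproj_isHermitian hS.inv.1).sub (wproj_isHermitian hS.inv.1)
  have hEQ : (Et N t)ᴴ * Q = 0 := by
    have := congrArg conjTranspose hQE
    rwa [conjTranspose_mul, hQh.eq, conjTranspose_zero] at this
  have hcomb : (L⁻¹)ᴴ * wproj (A N t r) (Sc M Z)⁻¹ * L⁻¹ - (L⁻¹)ᴴ * wproj (Et N t) (Sc M Z)⁻¹ * L⁻¹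
      = (L⁻¹)ᴴ * (Q * L⁻¹) := by
    rw [hQ]; simp only [Matrix.sub_mul, Matrix.mul_sub, Matrix.mul_assoc]
  have hL2 : IsUnit (Lᴴ).det := by rw [det_conjTranspose]; exact hL.star
  congr 1
  rw [hcomb, hY, conjTranspose_mul, conjTranspose_nonsing_inv]
  simp only [Matrix.mul_assoc]
  rw [mul_nonsing_inv_cancel_left _ _ hL2, nonsing_inv_mul_cancel_left _ _ hL, Matrix.mul_add,
    ← Matrix.mul_assoc Q (Et N t), hQE, Matrix.zero_mul, add_zero, conjTranspose_add, Matrix.add_mul,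
    conjTranspose_mul, Matrix.mul_assoc _ _ (Q * Y), ← Matrix.mul_assoc (Et N t)ᴴ, hEQ]
  simp

theorem law0_eq_gaussLaw (Bt : Matrix (Fin t) (Fin M) ℂ) (R : Matrix (Fin N) (Fin N) ℂ) :
    law0 K Bt R = gaussLaw (Et N t * Bt * C M K) R := rfl

theorem law1_eq_gaussLaw (Bs : Matrix (Fin t ⊕ Fin r) (Fin M) ℂ) (R : Matrix (Fin N) (Fin N) ℂ) :
    law1 K Bs R = gaussLaw (A N t r * Bs * C M K) R := rfl

/-- A statistic that is almost surely a function of the trace statistic is CFAR. -/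
theorem cfar_of_eq_waldTrace (htr : t + r ≤ N) (hK : M + N ≤ K)
    {T : Matrix (Fin N) (Fin K) ℂ → ℝ} {F : ℂ → ℝ}
    (hT : ∀ Z, (Sc M Z).PosDef → T Z = F (waldTrace M t r Z)) : CFAR M t T := by
  intro η
  -- The common false alarm probability is the one for zero mean and identity covariance.
  refine ⟨gaussLaw 0 1 {z | η < T (of z)}, fun Bt R hR => ?_⟩
  obtain ⟨L, hL, rfl, hL'⟩ := exists_upperTriangular_factor hR
  rw [law0_eq_gaussLaw, gaussLaw_eq_map hL, MeasurableEquiv.map_apply]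
  refine measure_congr ?_
  filter_upwards [ae_Sc_posDef hK 0 1] with g hg
  obtain ⟨h1, h2⟩ := waldTrace_affine htr (by omega) hL hL' Bt hg
  have h3 : T (of (affineEquiv L hL (Et N t * Bt * C M K) g)) = T (of g) := by
    have : of (affineEquiv L hL (Et N t * Bt * C M K) g) = L * of g + Et N t * Bt * C M K := rfl
    rw [this, hT _ h1, hT _ hg, h2]
  exact propext (by change η < T _ ↔ η < T _; rw [h3])

end CFAR

/-! ### Moments of the standard complex Gaussian law -/

section Moments

variable {N K : ℕ}

/-- The real inner product `Re Tr(D† W)`. -/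
def realInner {n k : Type*} [Fintype n] [Fintype k] (D W : Matrix n k ℂ) : ℝ := (trace (Dᴴ * W)).re

theorem realInner_comm {n k : Type*} [Fintype n] [Fintype k] (D W : Matrix n k ℂ) :
    realInner D W = realInner W D := by
  have h : trace (Dᴴ * W) = star (trace (Wᴴ * D)) := by
    rw [← trace_conjTranspose, conjTranspose_mul, conjTranspose_conjTranspose]
  rw [realInner, realInner, h]
  exact Complex.conj_re _

theorem realInner_add_smul (D W V : Matrix (Fin N) (Fin K) ℂ) (s : ℝ) :
    realInner D (W + s • V) = realInner D W + s * realInner D V := by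
  simp [realInner, Matrix.mul_add, trace_add]

theorem realInner_self (g : Fin N → Fin K → ℂ) : realInner (of g) (of g) = sumSq g := by
  rw [realInner, Matrix.trace_mul_comm, trace_mul_conjTranspose_re]

theorem sumSq_add_smul (g v : Fin N → Fin K → ℂ) (s : ℝ) :
    sumSq (g + s • v) = sumSq g + 2 * s * realInner (of g) (of v) + s ^ 2 * sumSq v := by
  have h : of (g + s • v) = of g + s • of v := rfl
  rw [← realInner_self, h, realInner_add_smul, realInner_comm _ (of g), realInner_comm _ (of v),
    realInner_add_smul, realInner_add_smul, realInner_self, realInner_self,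
    realInner_comm (of v)]
  ring

theorem abs_realInner_le (D : Matrix (Fin N) (Fin K) ℂ) (g : Fin N → Fin K → ℂ) :
    |2 * realInner D (of g)| ≤ sumSq D + sumSq g := by
  let D' : Fin N → Fin K → ℂ := D
  have h1 := sumSq_nonneg (D' + (1 : ℝ) • g)
  have h2 := sumSq_nonneg (D' + (-1 : ℝ) • g)
  rw [sumSq_add_smul] at h1 h2
  have e : realInner (of D') (of g) = realInner D (of g) := rfl
  have e' : sumSq D = sumSq D' := rfl
  rw [e] at h1 h2
  rw [abs_le, e']
  constructor <;> linarith

/-- The score of the standard Gaussian law in the direction of mean `D` and covariance `H`. -/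
def stdScore (D : Matrix (Fin N) (Fin K) ℂ) (H : Matrix (Fin N) (Fin N) ℂ)
    (g : Fin N → Fin K → ℂ) : ℝ :=
  2 * realInner D (of g) + ((trace (H * (of g * (of g)ᴴ))).re - K * (trace H).re)

theorem continuous_realInner (D : Matrix (Fin N) (Fin K) ℂ) :
    Continuous fun g : Fin N → Fin K → ℂ => realInner D (of g) :=
  Complex.continuous_re.comp
    (Continuous.matrix_trace (continuous_const.matrix_mul (continuous_id (X := Fin N → Fin K → ℂ))))

theorem continuous_stdScore (D : Matrix (Fin N) (Fin K) ℂ) (H : Matrix (Fin N) (Fin N) ℂ) :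
    Continuous (stdScore D H) := by
  have h : Continuous fun g : Fin N → Fin K → ℂ => of g := continuous_id (X := Fin N → Fin K → ℂ)
  refine (continuous_const.mul (continuous_realInner D)).add (Continuous.sub ?_ continuous_const)
  exact Complex.continuous_re.comp (Continuous.matrix_trace
    (continuous_const.matrix_mul (h.matrix_mul h.matrix_conjTranspose)))

theorem sumSq_mul_le (H : Matrix (Fin N) (Fin N) ℂ) (g : Fin N → Fin K → ℂ) :
    sumSq (H * of g) ≤ sumSq H * sumSq g := by
  have h : ∀ i j, ‖(H * of g) i j‖ ^ 2 ≤ (∑ k, ‖H i k‖ ^ 2) * ∑ k, ‖g k j‖ ^ 2 := fun i j => by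
    refine le_trans (pow_le_pow_left₀ (norm_nonneg _) ?_ 2)
      (Finset.sum_mul_sq_le_sq_mul_sq Finset.univ (fun k => ‖H i k‖) fun k => ‖g k j‖)
    rw [Matrix.mul_apply]
    exact (norm_sum_le _ _).trans_eq (by simp)
  calc sumSq (H * of g) ≤ ∑ i, ∑ j, (∑ k, ‖H i k‖ ^ 2) * ∑ k, ‖g k j‖ ^ 2 :=
        Finset.sum_le_sum fun i _ => Finset.sum_le_sum fun j _ => h i j
    _ = sumSq H * sumSq g := by
        simp only [← Finset.mul_sum, ← Finset.sum_mul, sumSq]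
        rw [Finset.sum_comm (f := fun j k => ‖g k j‖ ^ 2)]

theorem exists_abs_stdScore_le (D : Matrix (Fin N) (Fin K) ℂ) (H : Matrix (Fin N) (Fin N) ℂ) :
    ∃ c, 0 ≤ c ∧ ∀ g, |stdScore D H g| ≤ c * (1 + sumSq g) := by
  have hD := sumSq_nonneg D
  have hH := sumSq_nonneg Hᴴ
  refine ⟨sumSq D + sumSq Hᴴ + |K * (trace H).re| + 2, by positivity, fun g => ?_⟩
  have hg := sumSq_nonneg g
  have h1 := abs_realInner_le D g
  have h2 : (trace (H * (of g * (of g)ᴴ))).re = realInner (Hᴴ * of g) (of g) := by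
    rw [realInner, conjTranspose_mul, conjTranspose_conjTranspose, ← Matrix.mul_assoc,
      Matrix.trace_mul_comm, ← Matrix.mul_assoc]
  have h3 := abs_realInner_le (Hᴴ * of g) g
  rw [abs_mul, ← h2, abs_of_pos (two_pos : (0 : ℝ) < 2)] at h3
  have h4 := sumSq_mul_le Hᴴ g
  have h5 : |stdScore D H g| ≤ |2 * realInner D (of g)| + (|(trace (H * (of g * (of g)ᴴ))).re| +
      |K * (trace H).re|) := (abs_add_le _ _).trans (by gcongr; exact abs_sub _ _)
  have h6 := abs_nonneg (K * (trace H).re)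
  nlinarith [mul_nonneg hD hg, mul_nonneg h6 hg, mul_nonneg hH hg,
    abs_nonneg ((trace (H * (of g * (of g)ᴴ))).re)]

theorem integrable_mul_exp_of_le {h : (Fin N → Fin K → ℂ) → ℝ} (hc : Continuous h) {c : ℝ}
    (hle : ∀ g, |h g| ≤ c * (1 + sumSq g) ^ 2) :
    Integrable fun g => h g * Real.exp (-sumSq g) := by
  have hcont : Continuous fun g : Fin N → Fin K → ℂ => sumSq g := by
    unfold sumSq; fun_prop
  have hdom := (integrable_exp_neg_mul_sumSq (N := N) (K := K) (b := 1 / 2) (by norm_num)).const_mul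
    (c * 8)
  refine hdom.mono' (hc.mul (Real.continuous_exp.comp hcont.neg)).aestronglyMeasurable
    (Filter.Eventually.of_forall fun g => ?_)
  have hg := sumSq_nonneg g
  have hc0 : 0 ≤ c := by
    have := (abs_nonneg _).trans (hle g)
    exact (mul_nonneg_iff_of_pos_right (by positivity)).1 this
  -- Half of the Gaussian decay absorbs the polynomial: `exp x ≥ 1 + x + x²/2` at `x = sumSq g / 2`,
  -- and the constant `8` normalizes the quadratic term.
  have h1 : (1 + sumSq g) ^ 2 ≤ 8 * Real.exp (sumSq g / 2) := by
    have := Real.quadratic_le_exp_of_nonneg (x := sumSq g / 2) (by positivity)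
    nlinarith
  have h2 : Real.exp (sumSq g / 2) * Real.exp (-sumSq g) = Real.exp (-(1 / 2) * sumSq g) := by
    rw [← Real.exp_add]; congr 1; ring
  rw [Real.norm_eq_abs, abs_mul, abs_of_pos (Real.exp_pos _)]
  calc |h g| * Real.exp (-sumSq g) ≤ c * (8 * Real.exp (sumSq g / 2)) * Real.exp (-sumSq g) := by
        gcongr
        exact (hle g).trans (mul_le_mul_of_nonneg_left h1 hc0)
    _ = c * 8 * (Real.exp (sumSq g / 2) * Real.exp (-sumSq g)) := by ring
    _ = _ := by rw [h2]

theorem integral_std (h : (Fin N → Fin K → ℂ) → ℝ) :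
    ∫ g, h g ∂gaussLaw 0 1 =
      (Real.pi ^ (N * K))⁻¹ * ∫ g, h g * Real.exp (-sumSq g) := by
  have hm : Measurable fun z : Fin N → Fin K → ℂ => ENNReal.ofReal (gaussianPdf 0 1 (of z)) :=
    (continuous_gaussianPdf 0 1).measurable.ennreal_ofReal
  rw [gaussLaw, integral_withDensity_eq_integral_toReal_smul₀ hm.aemeasurable
    (Filter.Eventually.of_forall fun _ => ENNReal.ofReal_lt_top), ← integral_const_mul]
  refine integral_congr_ae (Filter.Eventually.of_forall fun g => ?_)
  have := Real.pi_pos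
  change (ENNReal.ofReal (gaussianPdf 0 1 (of g))).toReal • h g = _
  rw [gaussianPdf_std, ENNReal.toReal_ofReal (by positivity), smul_eq_mul]
  ring

theorem integrable_std {h : (Fin N → Fin K → ℂ) → ℝ}
    (hi : Integrable fun g => h g * Real.exp (-sumSq g)) :
    Integrable h (gaussLaw 0 1) := by
  have hm : Measurable fun z : Fin N → Fin K → ℂ => ENNReal.ofReal (gaussianPdf 0 1 (of z)) :=
    (continuous_gaussianPdf 0 1).measurable.ennreal_ofReal
  rw [gaussLaw, integrable_withDensity_iff_integrable_smul' hm
    (Filter.Eventually.of_forall fun _ => ENNReal.ofReal_lt_top)]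
  refine (hi.const_mul (Real.pi ^ (N * K))⁻¹).congr (Filter.Eventually.of_forall fun g => ?_)
  have := Real.pi_pos
  change _ = (ENNReal.ofReal (gaussianPdf 0 1 (of g))).toReal • h g
  rw [gaussianPdf_std, ENNReal.toReal_ofReal (by positivity), smul_eq_mul]
  ring

theorem abs_mul_le_of_le {a b c d u : ℝ} (hc : 0 ≤ c) (hu : 0 ≤ u) (ha : |a| ≤ c * (1 + u))
    (hb : |b| ≤ d * (1 + u)) : |a * b| ≤ c * d * (1 + u) ^ 2 := by
  rw [abs_mul]
  calc |a| * |b| ≤ (c * (1 + u)) * (d * (1 + u)) := by gcongr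
    _ = _ := by ring

theorem integrable_stdScore_mul_exp (D D' : Matrix (Fin N) (Fin K) ℂ)
    (H H' : Matrix (Fin N) (Fin N) ℂ) :
    Integrable fun g => stdScore D H g * stdScore D' H' g * Real.exp (-sumSq g) := by
  obtain ⟨c, hc, h⟩ := exists_abs_stdScore_le D H
  obtain ⟨c', -, h'⟩ := exists_abs_stdScore_le D' H'
  exact integrable_mul_exp_of_le ((continuous_stdScore D H).mul (continuous_stdScore D' H'))
    fun g => abs_mul_le_of_le hc (sumSq_nonneg g) (h g) (h' g)

theorem integrable_stdScore_mul (D D' : Matrix (Fin N) (Fin K) ℂ)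
    (H H' : Matrix (Fin N) (Fin N) ℂ) :
    Integrable (fun g => stdScore D H g * stdScore D' H' g) (gaussLaw 0 1) :=
  integrable_std (integrable_stdScore_mul_exp D D' H H')

theorem stdScore_zero_right (D : Matrix (Fin N) (Fin K) ℂ) (g : Fin N → Fin K → ℂ) :
    stdScore D 0 g = 2 * realInner D (of g) := by
  simp [stdScore]

theorem stdScore_add_eq (D : Matrix (Fin N) (Fin K) ℂ) (H : Matrix (Fin N) (Fin N) ℂ)
    (g : Fin N → Fin K → ℂ) : stdScore D H g = stdScore D 0 g + stdScore 0 H g := by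
  simp [stdScore, realInner]

theorem stdScore_neg_left (D : Matrix (Fin N) (Fin K) ℂ) (g : Fin N → Fin K → ℂ) :
    stdScore D 0 (-g) = -stdScore D 0 g := by
  have e : of (-g) = -of g := rfl
  rw [stdScore_zero_right, stdScore_zero_right, e, realInner, realInner, Matrix.mul_neg, trace_neg,
    Complex.neg_re]
  ring

theorem stdScore_neg_right (H : Matrix (Fin N) (Fin N) ℂ) (g : Fin N → Fin K → ℂ) :
    stdScore 0 H (-g) = stdScore 0 H g := by
  have e : of (-g) = -of g := rfl
  rw [stdScore, stdScore, e, conjTranspose_neg, Matrix.neg_mul (of g), Matrix.mul_neg (of g),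
    neg_neg]
  simp [realInner]

theorem sumSq_neg (g : Fin N → Fin K → ℂ) : sumSq (-g) = sumSq g := by simp [sumSq]

/-- The integrand is odd under `g ↦ -g`, a symmetry of the standard law. Consequently mean and
covariance parameters do not interact in the Fisher matrix. -/
theorem integral_stdScore_odd (D : Matrix (Fin N) (Fin K) ℂ) (H : Matrix (Fin N) (Fin N) ℂ) :
    ∫ g, stdScore 0 H g * stdScore D 0 g ∂gaussLaw 0 1 = 0 := by
  rw [integral_std]
  have : (volume : Measure (Fin N → Fin K → ℂ)).IsNegInvariant :=
    Measure.IsAddHaarMeasure.isNegInvariant_of_innerRegular _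
  have h := integral_neg_eq_self
    (fun g : Fin N → Fin K → ℂ => stdScore 0 H g * stdScore D 0 g * Real.exp (-sumSq g)) volume
  simp only [stdScore_neg_left, stdScore_neg_right, sumSq_neg, mul_neg, neg_mul,
    integral_neg] at h
  have h0 : ∫ g : Fin N → Fin K → ℂ, stdScore 0 H g * stdScore D 0 g * Real.exp (-sumSq g) = 0 := by
    linarith
  rw [h0, mul_zero]

/-- Integration by parts along `D'`: the Gaussian weight has derivative `-stdScore D' 0` times
itself, while `stdScore D 0` has the constant derivative `2 * realInner D D'`. -/
theorem integral_stdScore_linear (D D' : Matrix (Fin N) (Fin K) ℂ) :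
    ∫ g, stdScore D 0 g * stdScore D' 0 g ∂gaussLaw 0 1 = 2 * realInner D D' := by
  have hint := integrable_stdScore_mul_exp D D' 0 0
  have hD : Integrable fun g => stdScore D 0 g * Real.exp (-sumSq g) := by
    obtain ⟨c, hc, h⟩ := exists_abs_stdScore_le D 0
    refine integrable_mul_exp_of_le (c := c) (continuous_stdScore D 0) fun g => (h g).trans ?_
    have := sumSq_nonneg g
    gcongr
    nlinarith
  have h1 : Integrable fun g : Fin N → Fin K → ℂ => Real.exp (-sumSq g) := by
    simpa using integrable_exp_neg_mul_sumSq (N := N) (K := K) one_pos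
  have h1i : ∫ g : Fin N → Fin K → ℂ, Real.exp (-sumSq g) = Real.pi ^ (N * K) := by
    simpa using integral_exp_neg_mul_sumSq (N := N) (K := K) one_pos
  let v : Fin N → Fin K → ℂ := D'
  have hparts := integral_bilinear_hasLineDerivAt_right_eq_neg_left_of_integrable
    (μ := (volume : Measure (Fin N → Fin K → ℂ))) (v := v) (B := ContinuousLinearMap.mul ℝ ℝ)
    (f := stdScore D 0) (f' := fun _ => 2 * realInner D D')
    (g := fun g => Real.exp (-sumSq g))
    (g' := fun g => -(stdScore D' 0 g * Real.exp (-sumSq g)))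
    (h1.const_mul _)
    (hint.neg.congr (Filter.Eventually.of_forall fun g => by simp; ring))
    hD
    (fun g _ => by
      have : (fun s : ℝ => stdScore D 0 (g + s • v)) = fun s =>
          2 * (realInner D (of g) + s * realInner D D') := by
        funext s
        rw [stdScore_zero_right]
        exact congrArg (2 * ·) (realInner_add_smul D (of g) D' s)
      rw [HasLineDerivAt, this]
      have := (((hasDerivAt_id (0 : ℝ)).mul_const (realInner D D')).const_add
        (realInner D (of g))).const_mul 2
      simpa using this)
    (fun g _ => by
      have : (fun s : ℝ => Real.exp (-sumSq (g + s • v))) = fun s =>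
          Real.exp (-(sumSq g + 2 * s * realInner (of g) D' + s ^ 2 * sumSq v)) := by
        funext s
        rw [sumSq_add_smul]; rfl
      rw [HasLineDerivAt, this, stdScore_zero_right, realInner_comm D']
      have := ((((hasDerivAt_id (0 : ℝ)).const_mul 2).mul_const (realInner (of g) D')).const_add
        (sumSq g)).add (((hasDerivAt_id (0 : ℝ)).pow 2).mul_const (sumSq v))
      convert! this.neg.exp using 1
      simp
      ring)
  simp only [ContinuousLinearMap.mul_apply', mul_neg, integral_neg, neg_inj, integral_const_mul,
    h1i] at hparts
  rw [integral_std]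
  have := Real.pi_pos
  simp only [← mul_assoc] at hparts
  rw [hparts]
  field_simp

theorem integral_stdScore_mul_linear (D D' : Matrix (Fin N) (Fin K) ℂ)
    (H : Matrix (Fin N) (Fin N) ℂ) :
    ∫ g, stdScore D H g * stdScore D' 0 g ∂gaussLaw 0 1 = 2 * realInner D D' := by
  have : (fun g => stdScore D H g * stdScore D' 0 g) = fun g =>
      stdScore D 0 g * stdScore D' 0 g + stdScore 0 H g * stdScore D' 0 g := by
    funext g
    rw [stdScore_add_eq D H]; ring
  rw [this, integral_add (integrable_stdScore_mul D D' 0 0) (integrable_stdScore_mul 0 D' H 0),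
    integral_stdScore_linear, integral_stdScore_odd, add_zero]

theorem stdScore_eq_zero_of_integral (D : Matrix (Fin N) (Fin K) ℂ)
    (H : Matrix (Fin N) (Fin N) ℂ)
    (h : ∫ g, stdScore D H g * stdScore D H g ∂gaussLaw 0 1 = 0) : ∀ g, stdScore D H g = 0 := by
  have hpi := Real.pi_pos
  rw [integral_std] at h
  have h0 : ∫ g, stdScore D H g * stdScore D H g * Real.exp (-sumSq g) = 0 :=
    (mul_eq_zero.1 h).resolve_left (by positivity)
  rw [integral_eq_zero_iff_of_nonneg
    (fun g => mul_nonneg (mul_self_nonneg (stdScore D H g)) (Real.exp_pos _).le)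
    (integrable_stdScore_mul_exp D D H H)] at h0
  have h1 : stdScore D H =ᵐ[volume] fun _ => 0 := by
    filter_upwards [h0] with g hg
    have := (mul_eq_zero.1 hg).resolve_right (Real.exp_pos _).ne'
    exact mul_self_eq_zero.1 this
  have := Continuous.ae_eq_iff_eq volume (continuous_stdScore D H) continuous_const |>.1 h1
  exact fun g => congrFun this g

/-- Identifiability, hence a nonsingular Fisher matrix. Parity separates the linear and quadratic
parts; the linear part at `g = D` is `2 * sumSq D`, and the quadratic part at `g = 0` gives `Tr H =
0`. -/
theorem stdScore_eq_zero_imp (hK : 0 < K) {D : Matrix (Fin N) (Fin K) ℂ}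
    {H : Matrix (Fin N) (Fin N) ℂ} (hH : H.IsHermitian) (h : ∀ g, stdScore D H g = 0) :
    D = 0 ∧ H = 0 := by
  have hlin : ∀ g, stdScore D 0 g = 0 := fun g => by
    have h1 := h g
    have h2 := h (-g)
    rw [stdScore_add_eq] at h1 h2
    rw [stdScore_neg_left, stdScore_neg_right] at h2
    linarith
  have hquad : ∀ g, stdScore (0 : Matrix (Fin N) (Fin K) ℂ) H g = 0 := fun g => by
    have h1 := h g
    rwa [stdScore_add_eq, hlin, zero_add] at h1
  have htr : (trace H).re = 0 := by
    have h0 := hquad 0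
    have : (of (0 : Fin N → Fin K → ℂ)) = 0 := rfl
    have hK' : (K : ℝ) ≠ 0 := by exact_mod_cast hK.ne'
    simpa [stdScore, realInner, this, hK'] using h0
  constructor
  · let D' : Fin N → Fin K → ℂ := D
    have h0 := hlin D'
    rw [stdScore_zero_right] at h0
    have h1 : realInner (of D') (of D') = 0 := by
      have : realInner D (of D') = 0 := by linarith
      exact this
    rw [realInner_self] at h1
    ext i j
    have h2 := (Finset.sum_eq_zero_iff_of_nonneg (fun i _ =>
      Finset.sum_nonneg fun j _ => sq_nonneg ‖D i j‖)).1 h1 i (Finset.mem_univ _)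
    have h3 := (Finset.sum_eq_zero_iff_of_nonneg (fun j _ => sq_nonneg ‖D i j‖)).1 h2 j
      (Finset.mem_univ _)
    simpa using h3
  · have htrace : trace H = 0 := by
      refine Complex.ext htr ?_
      have : star (trace H) = trace H := by rw [← trace_conjTranspose, hH.eq]
      exact Complex.conj_eq_iff_im.1 this
    refine ((PosSemidef.of_dotProduct_mulVec_nonneg hH fun v => ?_).trace_eq_zero_iff).1 htrace
    -- Data with the single nonzero column `v` turn the quadratic part into `v† H v`, which
    -- therefore vanishes; nonnegativity together with zero trace suffices for `H = 0`.
    let g : Fin N → Fin K → ℂ := fun i k => if k = ⟨0, hK⟩ then v i else 0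
    have hg := hquad g
    have h1 : of g * (of g)ᴴ = vecMulVec v (star v) := by
      ext i j
      simp [Matrix.mul_apply, g, vecMulVec_apply]
    rw [stdScore, h1, htr, mul_vecMulVec, trace_vecMulVec] at hg
    simp only [realInner, conjTranspose_zero, Matrix.zero_mul, trace_zero, Complex.zero_re,
      mul_zero, sub_zero, zero_add] at hg
    have him : (star v ⬝ᵥ H *ᵥ v).im = 0 := by
      have : star (star v ⬝ᵥ H *ᵥ v) = star v ⬝ᵥ H *ᵥ v := by
        rw [← star_dotProduct_star, star_star, star_mulVec, hH.eq,
          ← dotProduct_mulVec]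
      exact Complex.conj_eq_iff_im.1 this
    rw [dotProduct_comm] at hg
    exact Complex.nonneg_iff.2 ⟨hg.ge, him.symm⟩

end Moments

/-! ### The score -/

section Score

variable {N K : ℕ}

theorem hasDerivAt_det_add_smul {R : Matrix (Fin N) (Fin N) ℂ} (hR : R.PosDef)
    (H : Matrix (Fin N) (Fin N) ℂ) :
    HasDerivAt (fun s : ℝ => (R + s • H).det.re) (R.det.re * (trace (R⁻¹ * H)).re) 0 := by
  have hu : IsUnit R.det := (Matrix.isUnit_iff_isUnit_det _).1 hR.isUnit
  -- Dividing twice by the variable discards the constant and linear coefficients, so `p` is the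
  -- cofactor of `s²` in the expansion of `det(1 + s R⁻¹ H)`.
  set p := (det (1 + (Polynomial.X : Polynomial ℂ) • (R⁻¹ * H).map Polynomial.C)).divX.divX with hp
  have h1 : ∀ s : ℝ, (R + s • H).det =
      R.det * (1 + trace (R⁻¹ * H) * (s : ℂ) + p.eval (s : ℂ) * (s : ℂ) ^ 2) := fun s => by
    have e : R + s • H = R * (1 + (s : ℂ) • (R⁻¹ * H)) := by
      rw [Matrix.mul_add, Matrix.mul_one, Matrix.mul_smul, mul_nonsing_inv_cancel_left _ _ hu]
      rfl
    rw [e, det_mul, det_one_add_smul]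
  have hs : HasDerivAt (fun s : ℝ => (s : ℂ)) 1 0 := Complex.ofRealCLM.hasDerivAt
  have hpd : HasDerivAt (fun s : ℝ => p.eval (s : ℂ)) (p.derivative.eval ((0 : ℝ) : ℂ) * 1) 0 :=
    (p.hasDerivAt _).comp (0 : ℝ) hs
  have h2 : HasDerivAt (fun s : ℝ => (R + s • H).det) (R.det * trace (R⁻¹ * H)) 0 := by
    simp only [h1]
    have := (((hs.const_mul (trace (R⁻¹ * H))).const_add 1).add (hpd.mul (hs.pow 2))).const_mul R.det
    convert! this using 1
    simp
  have h3 := Complex.reCLM.hasFDerivAt.comp_hasDerivAt (0 : ℝ) h2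
  have h4 : (R.det * trace (R⁻¹ * H)).re = R.det.re * (trace (R⁻¹ * H)).re := by
    conv_lhs => rw [det_eq_ofReal hR.1]
    exact Complex.re_ofReal_mul _ _
  rw [← h4]
  exact h3

section InverseDerivative

open scoped Matrix.Norms.Operator

theorem hasDerivAt_trace_inv_mul {R : Matrix (Fin N) (Fin N) ℂ} (hR : IsUnit R)
    (H P Q T : Matrix (Fin N) (Fin N) ℂ) :
    HasDerivAt (fun s : ℝ => (trace ((R + s • H)⁻¹ * (P - s • Q + s ^ 2 • T))).re)
      (-(trace (R⁻¹ * H * R⁻¹ * P)).re - (trace (R⁻¹ * Q)).re) 0 := by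
  have h1 : HasDerivAt (fun s : ℝ => R + s • H) H 0 := by
    have := ((hasDerivAt_id (0 : ℝ)).smul_const H).const_add R
    rw [one_smul] at this
    exact this
  have h2 : HasDerivAt (fun s : ℝ => (R + s • H)⁻¹) (-(R⁻¹ * H * R⁻¹)) 0 := by
    obtain ⟨u, rfl⟩ := hR
    have hx : HasFDerivAt Ring.inverse (-ContinuousLinearMap.mulLeftRight ℝ
        (Matrix (Fin N) (Fin N) ℂ) ↑u⁻¹ ↑u⁻¹) ((u : Matrix (Fin N) (Fin N) ℂ) + (0 : ℝ) • H) := by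
      rw [zero_smul, add_zero]
      exact hasFDerivAt_ringInverse u
    have := hx.comp_hasDerivAt (0 : ℝ) h1
    simp only [nonsing_inv_eq_ringInverse, Ring.inverse_unit]
    convert! this using 1
  have h3 : HasDerivAt (fun s : ℝ => P - s • Q + s ^ 2 • T) (-Q) 0 := by
    have := (((hasDerivAt_id (0 : ℝ)).smul_const Q).const_sub P).add
      (((hasDerivAt_id (0 : ℝ)).pow 2).smul_const T)
    convert! this using 1
    simp
  have h4 := h2.mul h3
  let τ : Matrix (Fin N) (Fin N) ℂ →L[ℝ] ℝ :=
    Complex.reCLM.comp (LinearMap.toContinuousLinearMap (traceLinearMap (Fin N) ℝ ℂ))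
  have h5 := τ.hasFDerivAt.comp_hasDerivAt (0 : ℝ) h4
  convert! h5 using 1
  change _ = (trace (-(R⁻¹ * H * R⁻¹) * (P - (0 : ℝ) • Q + (0 : ℝ) ^ 2 • T) +
    (R + (0 : ℝ) • H)⁻¹ * -Q)).re
  simp [trace_add]
  ring

end InverseDerivative

/-- Derivative of the Gaussian log-likelihood in the direction of mean `D` and covariance `H`, as a
function of the centered data `W`. -/
def dirScore (R : Matrix (Fin N) (Fin N) ℂ) (D : Matrix (Fin N) (Fin K) ℂ)
    (H : Matrix (Fin N) (Fin N) ℂ) (W : Matrix (Fin N) (Fin K) ℂ) : ℝ :=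
  2 * realInner D (R⁻¹ * W) + ((trace (R⁻¹ * H * R⁻¹ * (W * Wᴴ))).re - K * (trace (R⁻¹ * H)).re)

theorem hasDerivAt_log_gaussianPdf {R : Matrix (Fin N) (Fin N) ℂ} (hR : R.PosDef)
    (X D Z : Matrix (Fin N) (Fin K) ℂ) (H : Matrix (Fin N) (Fin N) ℂ) :
    HasDerivAt (fun s : ℝ => Real.log (gaussianPdf (X + s • D) (R + s • H) Z))
      (dirScore R D H (Z - X)) 0 := by
  have hdet := hasDerivAt_det_add_smul hR H
  have hd0 : (R + (0 : ℝ) • H).det.re ≠ 0 := by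
    rw [zero_smul, add_zero]; exact (det_re_pos hR).ne'
  set W := Z - X with hW
  have hq : ∀ s : ℝ, (Z - (X + s • D)) * (Z - (X + s • D))ᴴ =
      W * Wᴴ - s • (D * Wᴴ + W * Dᴴ) + s ^ 2 • (D * Dᴴ) := fun s => by
    have e : Z - (X + s • D) = W - s • D := by rw [hW]; abel
    have e2 : (s • D)ᴴ = s • Dᴴ := by rw [conjTranspose_smul, star_trivial]
    rw [e, conjTranspose_sub, e2]
    simp only [Matrix.sub_mul, Matrix.mul_sub, Matrix.smul_mul, Matrix.mul_smul, smul_sub, smul_add,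
      pow_two, mul_smul]
    abel
  have htr := hasDerivAt_trace_inv_mul hR.isUnit H (W * Wᴴ) (D * Wᴴ + W * Dᴴ) (D * Dᴴ)
  have hlog := (hdet.log hd0).const_mul (K : ℝ)
  have hmain := (hlog.const_sub (-Real.log (Real.pi ^ (N * K)))).sub htr
  -- The logarithm of the density splits into a sum only where the determinant is nonzero, which
  -- holds near `s = 0`.
  have hev : ∀ᶠ s : ℝ in nhds 0, (R + s • H).det.re ≠ 0 :=
    hdet.continuousAt.eventually_ne hd0
  have hval : dirScore R D H W = -(K * (R.det.re * (trace (R⁻¹ * H)).re /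
      (R + (0 : ℝ) • H).det.re)) -
        (-(trace (R⁻¹ * H * R⁻¹ * (W * Wᴴ))).re - (trace (R⁻¹ * (D * Wᴴ + W * Dᴴ))).re) := by
    have h1 := (det_re_pos hR).ne'
    have e1 : (trace (R⁻¹ * (W * Dᴴ))).re = realInner D (R⁻¹ * W) := by
      rw [realInner, ← Matrix.mul_assoc, Matrix.trace_mul_comm]
    have e2 : (trace (R⁻¹ * (D * Wᴴ))).re = realInner D (R⁻¹ * W) := by
      rw [realInner_comm, realInner, conjTranspose_mul, hR.inv.1.eq, Matrix.mul_assoc,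
        ← Matrix.mul_assoc, Matrix.trace_mul_comm]
    rw [zero_smul, add_zero, mul_div_cancel_left₀ _ h1, Matrix.mul_add, trace_add, Complex.add_re,
      e1, e2, dirScore]
    ring
  rw [hval]
  refine hmain.congr_of_eventuallyEq (hev.mono fun s hs => ?_)
  have hpi := Real.pi_pos.ne'
  change Real.log (gaussianPdf (X + s • D) (R + s • H) Z) = _
  rw [gaussianPdf, hq, Real.log_mul (by positivity) (by positivity),
    Real.log_mul (by positivity) (by positivity), Real.log_inv, Real.log_inv, Real.log_pow (n := K),
    Real.log_exp]
  simp only [Pi.sub_apply]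
  ring

theorem dirScore_mul {L : Matrix (Fin N) (Fin N) ℂ} (hL : IsUnit L.det)
    (D : Matrix (Fin N) (Fin K) ℂ) (H : Matrix (Fin N) (Fin N) ℂ) (g : Fin N → Fin K → ℂ) :
    dirScore (L * Lᴴ) D H (L * of g) = stdScore (L⁻¹ * D) (L⁻¹ * H * (L⁻¹)ᴴ) g := by
  have hL2 : IsUnit (Lᴴ).det := by rw [det_conjTranspose]; exact hL.star
  have e1 : realInner D ((L * Lᴴ)⁻¹ * (L * of g)) = realInner (L⁻¹ * D) (of g) := by
    rw [realInner, realInner, Matrix.mul_inv_rev, Matrix.mul_assoc (Lᴴ)⁻¹,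
      nonsing_inv_mul_cancel_left _ _ hL, conjTranspose_mul, conjTranspose_nonsing_inv,
      Matrix.mul_assoc]
  have e2 : trace ((L * Lᴴ)⁻¹ * H * (L * Lᴴ)⁻¹ * (L * of g * (L * of g)ᴴ)) =
      trace (L⁻¹ * H * (L⁻¹)ᴴ * (of g * (of g)ᴴ)) := by
    have : (L * Lᴴ)⁻¹ * H * (L * Lᴴ)⁻¹ * (L * of g * (L * of g)ᴴ) =
        (Lᴴ)⁻¹ * (L⁻¹ * H * (L⁻¹)ᴴ * (of g * (of g)ᴴ) * Lᴴ) := by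
      simp only [Matrix.mul_inv_rev, conjTranspose_mul, conjTranspose_nonsing_inv, Matrix.mul_assoc]
      rw [nonsing_inv_mul_cancel_left _ _ hL]
    rw [this, Matrix.trace_mul_comm, Matrix.mul_assoc, mul_nonsing_inv _ hL2, Matrix.mul_one]
  have e3 : trace ((L * Lᴴ)⁻¹ * H) = trace (L⁻¹ * H * (L⁻¹)ᴴ) := by
    rw [Matrix.mul_inv_rev, Matrix.mul_assoc, Matrix.trace_mul_comm, conjTranspose_nonsing_inv]
  rw [dirScore, stdScore, e1, e2, e3]

end Score

/-! ### The parametrization -/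

section Parametrization

variable {N K M t r : ℕ}

/-- `BsOf` as a real linear map. -/
def BsLin (N t r M : ℕ) : Param N t r M →ₗ[ℝ] Matrix (Fin t ⊕ Fin r) (Fin M) ℂ where
  toFun := BsOf
  map_add' θ θ' := by
    ext (i | i) j <;> simp [BsOf] <;> ring
  map_smul' c θ := by
    ext (i | i) j <;> simp [BsOf] <;> ring

/-- `ROf` as a real linear map. -/
def RLin (N t r M : ℕ) : Param N t r M →ₗ[ℝ] Matrix (Fin N) (Fin N) ℂ where
  toFun := ROf
  map_add' θ θ' := by
    ext i j
    simp only [ROf, of_apply, Matrix.add_apply, Pi.add_apply, Complex.ofReal_add]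
    split_ifs <;> ring
  map_smul' c θ := by
    ext i j
    simp only [ROf, of_apply, Matrix.smul_apply, Pi.smul_apply, smul_eq_mul, Complex.ofReal_mul,
      RingHom.id_apply, Complex.real_smul]
    split_ifs <;> ring

theorem ROf_isHermitian (θ : Param N t r M) : (ROf θ).IsHermitian := by
  ext i j
  rw [conjTranspose_apply]
  simp only [ROf, of_apply]
  rcases lt_trichotomy i j with h | h | h
  · rw [if_neg h.ne', if_neg h.not_gt, if_neg h.ne, if_pos h]
    simp
  · subst h; simp
  · rw [if_neg h.ne, if_pos h, if_neg h.ne', if_neg h.not_gt]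
    simp [sub_eq_add_neg]

theorem BsOf_paramOf (p : Matrix (Fin t ⊕ Fin r) (Fin M) ℂ × Matrix (Fin N) (Fin N) ℂ) :
    BsOf (paramOf p) = p.1 := by
  ext (i | i) j <;> simp [BsOf, paramOf, mul_comm Complex.I, Complex.re_add_im]

theorem ROf_paramOf {p : Matrix (Fin t ⊕ Fin r) (Fin M) ℂ × Matrix (Fin N) (Fin N) ℂ}
    (hp : p.2.IsHermitian) : ROf (paramOf p) = p.2 := by
  have hc : ∀ i j, p.2 i j = star (p.2 j i) := fun i j => (hp.apply i j).symm
  ext i j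
  simp only [ROf, of_apply, paramOf, Sum.elim_inr]
  rcases lt_trichotomy i j with h | h | h
  · rw [if_neg h.ne, if_pos h, if_pos h.le, if_neg h.not_ge, mul_comm, Complex.re_add_im]
  · subst h
    have := hc i i
    simp only [if_true, le_refl]
    exact Complex.conj_eq_iff_re.1 this.symm
  · rw [if_neg h.ne', if_neg h.not_gt, if_pos h.le, if_neg h.not_ge, hc i j]
    refine Complex.ext ?_ ?_ <;> simp

theorem eq_zero_of_BsOf_ROf {θ : Param N t r M} (hB : BsOf θ = 0) (hR : ROf θ = 0) : θ = 0 := by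
  have hBr : ∀ i j, θ (.inl (.inl (i, j))) = 0 ∧ θ (.inl (.inr (i, j))) = 0 := fun i j => by
    have := congrFun (congrFun hB (.inr i)) j
    constructor
    · simpa [BsOf] using congrArg Complex.re this
    · simpa [BsOf] using congrArg Complex.im this
  have hBt : ∀ i j, θ (.inr (.inl (.inl (i, j)))) = 0 ∧ θ (.inr (.inl (.inr (i, j)))) = 0 :=
    fun i j => by
      have := congrFun (congrFun hB (.inl i)) j
      constructor
      · simpa [BsOf] using congrArg Complex.re this
      · simpa [BsOf] using congrArg Complex.im this
  have hRR : ∀ i j, θ (.inr (.inr (i, j))) = 0 := fun i j => by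
    rcases lt_trichotomy i j with h | h | h
    · have := congrArg Complex.re (congrFun (congrFun hR i) j)
      simpa [ROf, h.ne, h] using this
    · subst h
      have := congrArg Complex.re (congrFun (congrFun hR i) i)
      simpa [ROf] using this
    · have := congrArg Complex.im (congrFun (congrFun hR j) i)
      simpa [ROf, h.ne, h] using this
  funext a
  rcases a with (⟨i, j⟩ | ⟨i, j⟩) | (⟨i, j⟩ | ⟨i, j⟩) | ⟨i, j⟩
  · exact (hBr i j).1
  · exact (hBr i j).2
  · exact (hBt i j).1
  · exact (hBt i j).2
  · exact hRR i j

/-- A nuisance direction only moves the interference coefficients. -/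
theorem BsOf_of_interest_zero {θ : Param N t r M} (h : ∀ a, θ (.inl a) = 0) :
    ∃ b : Matrix (Fin t) (Fin M) ℂ, BsOf θ = fromRows b 0 := by
  refine ⟨of fun i j => BsOf θ (.inl i) j, ?_⟩
  ext (i | i) j
  · rfl
  · simp [BsOf, h]

theorem score_eq {θ : Param N t r M} (hR : (ROf θ).PosDef) (a : IdxR r M ⊕ IdxS N t M)
    (Z : Matrix (Fin N) (Fin K) ℂ) :
    score θ a Z = dirScore (ROf θ) (A N t r * BsOf (Pi.single a 1 : Param N t r M) * C M K)
      (ROf (Pi.single a 1 : Param N t r M)) (Z - A N t r * BsOf θ * C M K) := by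
  rw [score, lineDeriv]
  have h := hasDerivAt_log_gaussianPdf hR (A N t r * BsOf θ * C M K)
    (A N t r * BsOf (Pi.single a 1 : Param N t r M) * C M K) Z
    (ROf (Pi.single a 1 : Param N t r M))
  refine (h.congr_of_eventuallyEq (Filter.Eventually.of_forall fun s => ?_)).deriv
  have e1 : BsOf (θ + s • (Pi.single a 1 : Param N t r M)) =
      BsOf θ + s • BsOf (Pi.single a 1 : Param N t r M) := by
    have := (BsLin N t r M).map_add θ (s • (Pi.single a 1 : Param N t r M))
    rwa [map_smul] at this
  have e2 : ROf (θ + s • (Pi.single a 1 : Param N t r M)) =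
      ROf θ + s • ROf (Pi.single a 1 : Param N t r M) := by
    have := (RLin N t r M).map_add θ (s • (Pi.single a 1 : Param N t r M))
    rwa [map_smul] at this
  change Real.log (f1 Z (BsOf (θ + s • _)) (ROf (θ + s • _))) = _
  rw [e1, e2, f1, Matrix.mul_add, Matrix.add_mul, Matrix.mul_smul, Matrix.smul_mul]

end Parametrization

/-! ### Fisher information -/

section Fisher

variable {N K M t r : ℕ}

/-- The score in the parameter direction `v` as a function of whitened noise, for covariance
`L L†`. -/
def whitenedScore (K : ℕ) (L : Matrix (Fin N) (Fin N) ℂ) (v : Param N t r M)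
    (g : Fin N → Fin K → ℂ) : ℝ :=
  stdScore (L⁻¹ * (A N t r * BsOf v * C M K)) (L⁻¹ * ROf v * (L⁻¹)ᴴ) g

/-- `whitenedScore` as a linear function of the direction. -/
def whitenedScoreLin (K : ℕ) (L : Matrix (Fin N) (Fin N) ℂ) (g : Fin N → Fin K → ℂ) :
    Param N t r M →ₗ[ℝ] ℝ where
  toFun v := whitenedScore K L v g
  map_add' v w := by
    have e1 : BsOf (v + w) = BsOf v + BsOf w := (BsLin N t r M).map_add v w
    have e2 : ROf (v + w) = ROf v + ROf w := (RLin N t r M).map_add v w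
    rw [whitenedScore, e1, e2]
    simp only [whitenedScore, stdScore, realInner, Matrix.mul_add, Matrix.add_mul,
      conjTranspose_add, trace_add, Complex.add_re]
    ring
  map_smul' c v := by
    have e1 : BsOf (c • v) = c • BsOf v := (BsLin N t r M).map_smul c v
    have e2 : ROf (c • v) = c • ROf v := (RLin N t r M).map_smul c v
    rw [whitenedScore, e1, e2]
    simp only [whitenedScore, stdScore, realInner, Matrix.mul_smul, Matrix.smul_mul,
      conjTranspose_smul, trace_smul, Complex.smul_re, star_trivial, smul_eq_mul, RingHom.id_apply]
    ring

theorem whitenedScore_eq_sum (L : Matrix (Fin N) (Fin N) ℂ) (v : Param N t r M)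
    (g : Fin N → Fin K → ℂ) :
    whitenedScore K L v g = ∑ a, whitenedScore K L (Pi.single a 1 : Param N t r M) g * v a := by
  have h := (whitenedScoreLin (t := t) (r := r) (M := M) K L g).pi_apply_eq_sum_univ v
  refine h.trans (Finset.sum_congr rfl fun a _ => ?_)
  have : (fun j => if a = j then (1 : ℝ) else 0) = Pi.single a 1 := by
    funext j
    simp [Pi.single_apply, eq_comm]
  rw [this, smul_eq_mul, mul_comm]
  rfl

theorem integrable_whitenedScore_mul (L : Matrix (Fin N) (Fin N) ℂ) (v w : Param N t r M) :
    Integrable (fun g => whitenedScore K L v g * whitenedScore K L w g) (gaussLaw 0 1) :=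
  integrable_stdScore_mul _ _ _ _

/-- Centering and whitening the data turn the expectation under `θ` into one under the standard law;
the true mean drops out. -/
theorem fisher_apply {θ : Param N t r M} {L : Matrix (Fin N) (Fin N) ℂ} (hL : IsUnit L.det)
    (hθ : L * Lᴴ = ROf θ) (hR : (ROf θ).PosDef) (a b : IdxR r M ⊕ IdxS N t M) :
    fisher K θ a b = ∫ g, whitenedScore K L (Pi.single a 1 : Param N t r M) g *
      whitenedScore K L (Pi.single b 1 : Param N t r M) g ∂gaussLaw 0 1 := by
  rw [fisher, of_apply, law1_eq_gaussLaw, ← hθ, gaussLaw_eq_map hL, integral_map_equiv]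
  refine integral_congr_ae (Filter.Eventually.of_forall fun g => ?_)
  have hs : ∀ a, score θ a (of (affineEquiv L hL (A N t r * BsOf θ * C M K) g)) =
      whitenedScore K L (Pi.single a 1 : Param N t r M) g := fun a => by
    have e : of (affineEquiv L hL (A N t r * BsOf θ * C M K) g) - A N t r * BsOf θ * C M K =
        L * of g := add_sub_cancel_right (L * of g) (A N t r * BsOf θ * C M K)
    rw [score_eq hR, e, ← hθ, dirScore_mul hL, whitenedScore]
  simp only [hs]

theorem fisher_mulVec {θ : Param N t r M} {L : Matrix (Fin N) (Fin N) ℂ} (hL : IsUnit L.det)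
    (hθ : L * Lᴴ = ROf θ) (hR : (ROf θ).PosDef) (v : Param N t r M)
    (a : IdxR r M ⊕ IdxS N t M) :
    (fisher K θ *ᵥ v) a = ∫ g, whitenedScore K L (Pi.single a 1 : Param N t r M) g *
      whitenedScore K L v g ∂gaussLaw 0 1 := by
  simp only [whitenedScore_eq_sum L v, Finset.mul_sum, ← mul_assoc]
  rw [integral_finsetSum _ fun b _ => (integrable_whitenedScore_mul _ _ _).mul_const _]
  simp only [mulVec, dotProduct, integral_mul_const, fisher_apply hL hθ hR]

theorem dotProduct_fisher_mulVec {θ : Param N t r M} {L : Matrix (Fin N) (Fin N) ℂ}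
    (hL : IsUnit L.det) (hθ : L * Lᴴ = ROf θ) (hR : (ROf θ).PosDef) (v : Param N t r M) :
    v ⬝ᵥ (fisher K θ *ᵥ v) = ∫ g, whitenedScore K L v g * whitenedScore K L v g ∂gaussLaw 0 1 := by
  have h : (fun g => whitenedScore K L v g * whitenedScore K L v g) = fun g =>
      ∑ a, v a * (whitenedScore K L (Pi.single a 1 : Param N t r M) g * whitenedScore K L v g) := by
    funext g
    conv_lhs => enter [1]; rw [whitenedScore_eq_sum L v]
    rw [Finset.sum_mul]
    exact Finset.sum_congr rfl fun a _ => by ring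
  rw [h, integral_finsetSum _ fun b _ => (integrable_whitenedScore_mul _ _ _).const_mul _]
  simp only [dotProduct, integral_const_mul, fisher_mulVec hL hθ hR]

/-- The quadratic form is the second moment of the score in direction `v`. If it is zero the
continuous score vanishes everywhere, so the mean and covariance directions vanish, and the
parametrization is injective. -/
theorem fisher_posDef (htr : t + r ≤ N) (hMK : M ≤ K) (hK : 0 < K) {θ : Param N t r M}
    (hR : (ROf θ).PosDef) : (fisher K θ).PosDef := by
  obtain ⟨L, hL, hθ⟩ := exists_sqrt_factor hR
  have hL2 : IsUnit (Lᴴ).det := by rw [det_conjTranspose]; exact hL.star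
  refine PosDef.of_dotProduct_mulVec_pos ?_ fun v hv => ?_
  · ext a b
    rw [conjTranspose_apply, star_trivial, fisher_apply hL hθ hR, fisher_apply hL hθ hR]
    simp only [mul_comm]
  · rw [star_trivial, dotProduct_fisher_mulVec hL hθ hR]
    refine lt_of_le_of_ne (integral_nonneg fun g => mul_self_nonneg _) fun h0 => hv ?_
    have hH : (L⁻¹ * ROf v * (L⁻¹)ᴴ).IsHermitian := by
      unfold Matrix.IsHermitian
      rw [conjTranspose_mul, conjTranspose_mul, conjTranspose_conjTranspose,
        (ROf_isHermitian v).eq, Matrix.mul_assoc]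
    obtain ⟨h1, h2⟩ := stdScore_eq_zero_imp hK hH (stdScore_eq_zero_of_integral _ _ h0.symm)
    refine eq_zero_of_BsOf_ROf ?_ ?_
    · have h3 : A N t r * BsOf v * C M K = 0 := by
        have := congrArg (L * ·) h1
        simpa only [mul_nonsing_inv_cancel_left _ _ hL, Matrix.mul_zero] using this
      calc BsOf v = (A N t r)ᴴ * (A N t r * BsOf v * C M K) * (C M K)ᴴ := by
            rw [Matrix.mul_assoc _ (A N t r * BsOf v * C M K), Matrix.mul_assoc _ (C M K),
              C_orthonormal hMK, Matrix.mul_one, ← Matrix.mul_assoc, A_orthonormal htr,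
              Matrix.one_mul]
        _ = 0 := by rw [h3, Matrix.mul_zero, Matrix.zero_mul]
    · rw [conjTranspose_nonsing_inv] at h2
      calc ROf v = L * (L⁻¹ * ROf v * (Lᴴ)⁻¹) * Lᴴ := by
            rw [Matrix.mul_assoc L⁻¹, mul_nonsing_inv_cancel_left _ _ hL,
              nonsing_inv_mul_cancel_right _ _ hL2]
        _ = 0 := by rw [h2, Matrix.mul_zero, Matrix.zero_mul]

/-- The inverse of the leading block of `I⁻¹` evaluated through a vector annihilated by the trailing
rows of `I`. -/
theorem block_inv_quadraticForm {m n : Type*} [Fintype m] [DecidableEq m] [Fintype n]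
    [DecidableEq n] {J : Matrix (m ⊕ n) (m ⊕ n) ℝ} (hJ : J.PosDef) {v : m ⊕ n → ℝ}
    (hv : ∀ b, (J *ᵥ v) (.inr b) = 0) :
    (fun a => v (.inl a)) ⬝ᵥ (((J⁻¹).toBlocks₁₁)⁻¹ *ᵥ fun a => v (.inl a)) = v ⬝ᵥ (J *ᵥ v) := by
  have hJu : IsUnit J.det := (Matrix.isUnit_iff_isUnit_det _).1 hJ.isUnit
  have hB : ((J⁻¹).toBlocks₁₁).PosDef := hJ.inv.submatrix Sum.inl_injective
  have hBu : IsUnit ((J⁻¹).toBlocks₁₁).det := (Matrix.isUnit_iff_isUnit_det _).1 hB.isUnit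
  -- Since `J v = (w, 0)`, the leading rows of `J⁻¹ (J v) = v` say that the leading block of `J⁻¹`
  -- sends `w` to the leading part of `v`.
  set w : m → ℝ := fun a => (J *ᵥ v) (.inl a) with hw
  have h1 : (J⁻¹).toBlocks₁₁ *ᵥ w = fun a => v (.inl a) := by
    have h2 : J⁻¹ *ᵥ (J *ᵥ v) = v := by
      rw [mulVec_mulVec, nonsing_inv_mul _ hJu, one_mulVec]
    funext a
    rw [← congrFun h2 (.inl a)]
    simp [mulVec, dotProduct, Fintype.sum_sum_type, toBlocks₁₁, w]
    refine Finset.sum_eq_zero fun b _ => ?_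
    have := hv b
    simp [mulVec, dotProduct, Fintype.sum_sum_type] at this
    simp [this]
  have h3 : v ⬝ᵥ (J *ᵥ v) = (fun a => v (.inl a)) ⬝ᵥ w := by
    simp only [dotProduct, Fintype.sum_sum_type, hv, mul_zero, Finset.sum_const_zero, add_zero, hw]
  rw [h3]
  conv_lhs => rw [← h1]
  rw [mulVec_mulVec, nonsing_inv_mul _ hBu, one_mulVec, h1]

theorem realInner_whiten (hMK : M ≤ K) {L R : Matrix (Fin N) (Fin N) ℂ} (hL : L * Lᴴ = R)
    (P Q : Matrix (Fin N) (Fin M) ℂ) :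
    realInner (L⁻¹ * (P * C M K)) (L⁻¹ * (Q * C M K)) = (trace (Pᴴ * (R⁻¹ * Q))).re := by
  have e : (L⁻¹ * (P * C M K))ᴴ * (L⁻¹ * (Q * C M K)) = (C M K)ᴴ * (Pᴴ * (R⁻¹ * Q) * C M K) := by
    rw [← hL, Matrix.mul_inv_rev]
    simp only [conjTranspose_mul, conjTranspose_nonsing_inv, Matrix.mul_assoc]
  rw [realInner, e, Matrix.trace_mul_comm, Matrix.mul_assoc, C_orthonormal hMK, Matrix.mul_one]

/-- The Wald form equals the quadratic form of the coefficients `Δ` that share the useful-signal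
part of `θ` and are orthogonal to the interference. -/
theorem waldForm_eq (htr : t + r ≤ N) (hMK : M ≤ K) (hK : 0 < K) {θ : Param N t r M}
    (hR : (ROf θ).PosDef) (Δ : Matrix (Fin t ⊕ Fin r) (Fin M) ℂ)
    (hΔ : ∀ i j, Δ (.inr i) j = BsOf θ (.inr i) j)
    (horth : (Et N t)ᴴ * ((ROf θ)⁻¹ * (A N t r * Δ)) = 0) :
    waldForm K θ = 2 * (trace ((A N t r * Δ)ᴴ * ((ROf θ)⁻¹ * (A N t r * Δ)))).re := by
  obtain ⟨L, hL, hθ⟩ := exists_sqrt_factor hR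
  set v : Param N t r M := paramOf (Δ, (0 : Matrix (Fin N) (Fin N) ℂ)) with hv
  have hvB : BsOf v = Δ := BsOf_paramOf _
  have hvR : ROf v = 0 := ROf_paramOf isHermitian_zero
  have hvr : (fun a => v (.inl a)) = fun a => θ (.inl a) := by
    funext a
    rcases a with ⟨i, j⟩ | ⟨i, j⟩ <;> simp [v, paramOf, hΔ, BsOf]
  have hws : ∀ g, whitenedScore K L v g = stdScore (L⁻¹ * (A N t r * Δ * C M K)) 0 g := fun g => by
    rw [whitenedScore, hvB, hvR, Matrix.mul_zero, Matrix.zero_mul]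
  have hIv : ∀ w : Param N t r M, ∫ g, whitenedScore K L w g * whitenedScore K L v g ∂gaussLaw 0 1 =
      2 * (trace ((A N t r * BsOf w)ᴴ * ((ROf θ)⁻¹ * (A N t r * Δ)))).re := fun w => by
    simp only [hws]
    rw [← realInner_whiten hMK hθ, ← integral_stdScore_mul_linear]
    rfl
  -- A nuisance direction moves the mean only within the range of `E_t`, to which `A Δ` is
  -- `R⁻¹`-orthogonal; its covariance part is uncorrelated with the purely linear score of `v`.
  have hnuis : ∀ b, (fisher K θ *ᵥ v) (.inr b) = 0 := fun b => by
    rw [fisher_mulVec hL hθ hR, hIv]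
    obtain ⟨c, hc⟩ := BsOf_of_interest_zero (N := N) (t := t) (r := r) (M := M)
      (θ := Pi.single (.inr b) 1) (fun a => by simp)
    rw [hc, A_mul_inl, conjTranspose_mul, Matrix.mul_assoc, horth, Matrix.mul_zero, trace_zero,
      Complex.zero_re, mul_zero]
  rw [waldForm, ← hvr, block_inv_quadraticForm (fisher_posDef htr hMK hK hR) hnuis,
    dotProduct_fisher_mulVec hL hθ hR, hIv, hvB]

end Fisher

/-! ### The Wald and two-step GLR statistics -/

section Statistics

variable {N K M t r : ℕ}

/-- The estimate differs from `S_c / K` by a multiple of `D D†`, and `D† S_c⁻¹ A = 0` by the normal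
equations, so this correction is invisible on the columns of `S_c⁻¹ A`. -/
theorem inv_covHat_mul_A (htr : t + r ≤ N) (hK : 0 < K) {Z : Matrix (Fin N) (Fin K) ℂ}
    (hS : (Sc M Z).PosDef) :
    (covHat M t r Z)⁻¹ * A N t r = (K : ℂ) • ((Sc M Z)⁻¹ * A N t r) := by
  have hA := A_orthonormal htr
  have hK0 : (K : ℂ) ≠ 0 := by exact_mod_cast hK.ne'
  have hSu := (Matrix.isUnit_iff_isUnit_det _).1 hS.isUnit
  have hRu := (Matrix.isUnit_iff_isUnit_det _).1 (covHat_posDef (t := t) (r := r) hK hS).isUnit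
  set D := Z * (C M K)ᴴ - A N t r * coefHat M t r Z with hD
  have h0 : Dᴴ * ((Sc M Z)⁻¹ * A N t r) = 0 := by
    have := congrArg conjTranspose (residual_orthogonal hA hS.inv (Z * (C M K)ᴴ))
    simp only [conjTranspose_mul, conjTranspose_conjTranspose, hS.inv.1.eq, conjTranspose_zero,
      Matrix.mul_assoc] at this
    exact this
  have h1 : covHat M t r Z * ((K : ℂ) • ((Sc M Z)⁻¹ * A N t r)) = A N t r := by
    rw [covHat, Matrix.mul_smul, Matrix.smul_mul, smul_smul, mul_inv_cancel₀ hK0, one_smul,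
      residualCov, ← hD, Matrix.add_mul, Matrix.mul_assoc D, h0, Matrix.mul_zero, add_zero,
      mul_nonsing_inv_cancel_left _ _ hSu]
  conv_lhs => rw [← h1]
  rw [nonsing_inv_mul_cancel_left _ _ hRu]

theorem wald_eq (htr : t + r ≤ N) (hMK : M ≤ K) (hK : 0 < K) {Z : Matrix (Fin N) (Fin K) ℂ}
    (hS : (Sc M Z).PosDef) : wald M t r Z = 2 * K * (waldTrace M t r Z).re := by
  have hA := A_orthonormal htr
  have hE := Et_orthonormal (N := N) (t := t) (by omega)
  have hRpd := covHat_posDef (t := t) (r := r) hK hS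
  set θ : Param N t r M := paramOf (coefHat M t r Z, covHat M t r Z) with hθ
  have hB : BsOf θ = coefHat M t r Z := BsOf_paramOf _
  have hR : ROf θ = covHat M t r Z := ROf_paramOf hRpd.1
  set G := (Sc M Z)⁻¹ with hG
  have hGpd : G.PosDef := hS.inv
  set Y := Z * (C M K)ᴴ with hY
  set w := wls (Et N t) G Y with hw
  -- Subtracting the fit on `E_t` alone leaves the useful-signal block untouched, and `A Δ` becomes
  -- the difference of the two fits, orthogonal to `E_t` for the weight `G`.
  set Δ : Matrix (Fin t ⊕ Fin r) (Fin M) ℂ := coefHat M t r Z - fromRows w 0 with hΔ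
  set u := A N t r * Δ with hu
  have hu' : u = A N t r * wls (A N t r) G Y - Et N t * w := by
    rw [hu, hΔ, Matrix.mul_sub, A_mul_inl]; rfl
  have hinv : (ROf θ)⁻¹ * u = (K : ℂ) • (G * u) := by
    rw [hR, hu, ← Matrix.mul_assoc, inv_covHat_mul_A htr hK hS, Matrix.smul_mul, Matrix.mul_assoc]
  have hGu : G * u = (wproj (A N t r) G - wproj (Et N t) G) * Y := by
    rw [hu', Matrix.mul_sub, Matrix.sub_mul, wproj_mul, wproj_mul]
  have hAu : (Et N t)ᴴ * (G * u) = 0 := by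
    have e := congrArg conjTranspose (A_mul_inl (N := N) (r := r) (1 : Matrix (Fin t) (Fin t) ℂ))
    rw [Matrix.mul_one, conjTranspose_mul] at e
    have h1 : (Et N t)ᴴ * (G * (A N t r * wls (A N t r) G Y)) = (Et N t)ᴴ * (G * Y) := by
      rw [← e, Matrix.mul_assoc, gram_mul_wls hA hGpd, Matrix.mul_assoc]
    rw [hu', Matrix.mul_sub, Matrix.mul_sub, h1, hw, gram_mul_wls hE hGpd, sub_self]
  -- `Y - u` is the full residual, orthogonal to the range of `A`, plus a vector in the range of
  -- `E_t`; both are `G`-orthogonal to `u`.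
  have hquad : uᴴ * (G * u) = Yᴴ * (G * u) := by
    have h2 : (Y - u)ᴴ * (G * u) = 0 := by
      have e : Y - u = (Y - A N t r * wls (A N t r) G Y) + Et N t * w := by rw [hu']; abel
      have h3 : (Y - A N t r * wls (A N t r) G Y)ᴴ * (G * A N t r) = 0 := by
        have := congrArg conjTranspose (residual_orthogonal hA hGpd Y)
        simpa only [conjTranspose_mul, conjTranspose_conjTranspose, hGpd.1.eq, conjTranspose_zero,
          Matrix.mul_assoc] using this
      rw [e, conjTranspose_add, Matrix.add_mul, conjTranspose_mul (Et N t), Matrix.mul_assoc wᴴ, hAu,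
        Matrix.mul_zero, add_zero, hu, ← Matrix.mul_assoc G, ← Matrix.mul_assoc, h3,
        Matrix.zero_mul]
    rw [conjTranspose_sub, Matrix.sub_mul] at h2
    exact (sub_eq_zero.1 h2).symm
  have hform := waldForm_eq htr hMK hK (θ := θ) (by rw [hR]; exact hRpd) Δ
    (fun i j => by rw [hB, hΔ]; simp)
    (by rw [← hu, hinv, Matrix.mul_smul, hAu, smul_zero])
  rw [wald, mle1_eq htr hMK hK hS, ← hθ, hform, ← hu, hinv, Matrix.mul_smul, trace_smul, hquad, hGu,
    waldTrace_eq, knownCovTrace_eq hMK hS, Matrix.mul_assoc, smul_eq_mul, ← Complex.ofReal_natCast,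
    Complex.re_ofReal_mul]
  ring

theorem waldTrace_eq_re (hMK : M ≤ K) {Z : Matrix (Fin N) (Fin K) ℂ} (hS : (Sc M Z).PosDef) :
    waldTrace M t r Z = ((waldTrace M t r Z).re : ℂ) := by
  refine Complex.ext (by simp) ?_
  rw [waldTrace_eq, knownCovTrace_im hMK hS, Complex.ofReal_im]

theorem wproj_smul {m n : Type*} [Fintype n] [Fintype m] [DecidableEq m] (X : Matrix n m ℂ)
    (G : Matrix n n ℂ) {c : ℂ} (hc : c ≠ 0) : wproj X (c • G) = c • wproj X G := by
  have h : (c • (Xᴴ * G * X))⁻¹ = c⁻¹ • (Xᴴ * G * X)⁻¹ := by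
    by_cases hu : IsUnit (Xᴴ * G * X).det
    · exact Matrix.inv_smul' _ (Units.mk0 c hc) hu
    -- In the singular case both inverses are `0` by convention, so the scaling rule still holds.
    · have hu' : ¬ IsUnit (c • (Xᴴ * G * X)).det := by
        rwa [det_smul, IsUnit.mul_iff, not_and_or, or_iff_right]
        exact not_not.2 ((isUnit_iff_ne_zero.2 hc).pow _)
      rw [nonsing_inv_apply_not_isUnit _ hu, nonsing_inv_apply_not_isUnit _ hu', smul_zero]
  simp only [wproj, Matrix.smul_mul, Matrix.mul_smul, h, smul_smul]
  congr 1
  field_simp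

theorem twoStepGLR_eq (htr : t + r ≤ N) (hMK : M < K) {Z : Matrix (Fin N) (Fin K) ℂ}
    (hS : (Sc M Z).PosDef) :
    twoStepGLR M t r Z = ((K : ℝ) - M) * (waldTrace M t r Z).re := by
  have hlt : (0 : ℝ) < (K : ℝ) - M := by
    have : (M : ℝ) < K := by exact_mod_cast hMK
    linarith
  have hc : ((K : ℂ) - M) = (((K : ℝ) - M : ℝ) : ℂ) := by push_cast; rfl
  have hc0 : ((K : ℂ) - M) ≠ 0 := by rw [hc]; exact_mod_cast hlt.ne'
  have hR : (Rsd M Z).PosDef := by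
    refine hS.smul ?_
    rw [hc]
    exact inv_pos.2 (by exact_mod_cast hlt)
  have hinv : (Rsd M Z)⁻¹ = ((K : ℂ) - M) • (Sc M Z)⁻¹ := by
    have := Matrix.inv_smul' (Sc M Z) (Units.mk0 _ (inv_ne_zero hc0))
      ((Matrix.isUnit_iff_isUnit_det _).1 hS.isUnit)
    rw [Rsd]
    refine this.trans ?_
    change (((K : ℂ) - M)⁻¹)⁻¹ • (Sc M Z)⁻¹ = _
    rw [inv_inv]
  have h := log_glrKnown htr hMK.le hR Z
  have h2 : knownCovTrace M t r (Rsd M Z) Z = ((K : ℂ) - M) * waldTrace M t r Z := by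
    rw [waldTrace_eq, knownCovTrace_eq hMK.le hR, knownCovTrace_eq hMK.le hS, hinv,
      wproj_smul _ _ hc0, wproj_smul _ _ hc0, ← smul_sub, Matrix.mul_smul, Matrix.smul_mul,
      trace_smul, smul_eq_mul]
  have h3 := congrArg Complex.re (h.trans h2)
  rw [Complex.ofReal_re, hc, Complex.re_ofReal_mul] at h3
  exact h3

end Statistics

end

end IGMANOVA

/-! ### The main theorem -/

open IGMANOVA
theorem lemma2 (N K M t r : ℕ) (hN : 0 < N) (htr : t + r ≤ N) (hK : M + N ≤ K) :
    -- known covariance: the maxima in the GLR are attained, and its logarithm is the trace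
    (∀ (R : Matrix (Fin N) (Fin N) ℂ) (Z : Matrix (Fin N) (Fin K) ℂ), R.PosDef →
      (∃ Bs : Matrix (Fin t ⊕ Fin r) (Fin M) ℂ,
        ∀ Bs' : Matrix (Fin t ⊕ Fin r) (Fin M) ℂ, f1 Z Bs' R ≤ f1 Z Bs R) ∧
      (∃ Bt : Matrix (Fin t) (Fin M) ℂ, ∀ Bt' : Matrix (Fin t) (Fin M) ℂ, f0 Z Bt' R ≤ f0 Z Bt R) ∧
      ((Real.log (glrKnown M t r R Z) : ℝ) : ℂ) = knownCovTrace M t r R Z) ∧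
    -- `S_c` is almost surely positive definite under both hypotheses
    (∀ (Bt : Matrix (Fin t) (Fin M) ℂ) (R : Matrix (Fin N) (Fin N) ℂ), R.PosDef →
      ∀ᵐ z ∂(law0 K Bt R), (Sc M (Matrix.of z)).PosDef) ∧
    (∀ (Bs : Matrix (Fin t ⊕ Fin r) (Fin M) ℂ) (R : Matrix (Fin N) (Fin N) ℂ), R.PosDef →
      ∀ᵐ z ∂(law1 K Bs R), (Sc M (Matrix.of z)).PosDef) ∧
    -- proportionality of the two-step GLR and Wald statistics
    (∀ Z : Matrix (Fin N) (Fin K) ℂ, (Sc M Z).PosDef →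
      (∃! p : Matrix (Fin t ⊕ Fin r) (Fin M) ℂ × Matrix (Fin N) (Fin N) ℂ, IsMLE1 Z p) ∧
      (twoStepGLR M t r Z : ℂ) = ((K : ℂ) - (M : ℂ)) * waldTrace M t r Z ∧
      (wald M t r Z : ℂ) = 2 * (K : ℂ) * waldTrace M t r Z ∧
      twoStepGLR M t r Z = ((K : ℝ) - (M : ℝ)) / (2 * (K : ℝ)) * wald M t r Z) ∧
    -- statistical equivalence and constant false alarm rate
    StatEquivalent (N := N) (K := K) M t r (twoStepGLR M t r) (wald M t r) ∧
    CFAR (N := N) (K := K) M t (wald M t r) ∧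
    CFAR (N := N) (K := K) M t (twoStepGLR M t r) := by
  -- Strictness comes from `N ≥ 1`; it makes `K - M` positive, hence the plug-in covariance well
  -- defined and the proportionality factor positive.
  have hMK : M < K := by omega
  have hK0 : 0 < K := by omega
  have hK' : (0 : ℝ) < K := by exact_mod_cast hK0
  have hlt : (0 : ℝ) < (K : ℝ) - M := by
    have : (M : ℝ) < K := by exact_mod_cast hMK
    linarith
  have hprop : ∀ Z : Matrix (Fin N) (Fin K) ℂ, (Sc M Z).PosDef →
      twoStepGLR M t r Z = ((K : ℝ) - (M : ℝ)) / (2 * (K : ℝ)) * wald M t r Z := fun Z hS => by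
    rw [twoStepGLR_eq htr hMK hS, wald_eq htr hMK.le hK0 hS]
    field_simp
  have hc : (0 : ℝ) < ((K : ℝ) - (M : ℝ)) / (2 * (K : ℝ)) := by positivity
  refine ⟨fun R Z hR => ⟨⟨_, gaussianPdf_le_wls hMK.le (A_orthonormal htr) hR Z⟩,
    ⟨_, gaussianPdf_le_wls hMK.le (Et_orthonormal (by omega)) hR Z⟩, log_glrKnown htr hMK.le hR Z⟩,
    fun Bt R _ => ae_Sc_posDef hK _ R, fun Bs R _ => ae_Sc_posDef hK _ R, fun Z hS => ⟨?_, ?_, ?_,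
      hprop Z hS⟩, ⟨OrderIso.mulLeft₀ _ hc, ?_, ?_⟩, ?_, ?_⟩
  · exact ⟨_, (isMLE1_iff htr hMK.le hK0 hS _).2 rfl, fun p hp =>
      (isMLE1_iff htr hMK.le hK0 hS p).1 hp⟩
  · rw [twoStepGLR_eq htr hMK hS, waldTrace_eq_re hMK.le hS]
    push_cast
    simp
  · rw [wald_eq htr hMK.le hK0 hS, waldTrace_eq_re hMK.le hS]
    push_cast
    simp
  · intro Bt R _
    filter_upwards [ae_Sc_posDef hK (Et N t * Bt * C M K) R] with z hz using hprop _ hz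
  · intro Bs R _
    filter_upwards [ae_Sc_posDef hK (A N t r * Bs * C M K) R] with z hz using hprop _ hz
  · exact cfar_of_eq_waldTrace htr hK (F := fun w => 2 * K * w.re) fun Z hS =>
      wald_eq htr hMK.le hK0 hS
  · exact cfar_of_eq_waldTrace htr hK (F := fun w => ((K : ℝ) - M) * w.re) fun Z hS =>
      twoStepGLR_eq htr hMK hS
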